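/- Let $(F,g_F)$ be a connected Riemannian manifold of dimension $n-1\ge 2$, let $I\subseteq\mathbb R$ be an open interval, let $f:I\to(0,\infty)$ be smooth, and let $\overline M=I\times_f F$ be the generalized Robertson–Walker (GRW) spacetime, i.e. the product manifold $I\times F$ with the Lorentzian metric $\overline g=-dt^2+f(t)^2 g_F$; write $\partial_t$ for the coordinate vector field of $I$. Let $\psi:M^k\to\overline M$ be a smooth spacelike immersion of a connected $k$-dimensional manifold, $k\le n-1$, and let $g=\psi^*\overline g$ be the induced Riemannian metric on $M$. Let $\tau$ be the height function, i.e. the $I$-component of $\psi$. Let $\overrightarrow H=\frac1k\,\mathrm{trace}_g(\mathrm{II})$ be the mean curvature vector, where $\mathrm{II}(X,Y)=-(\overline\nabla_XY)^\perp$ and $\overline\nabla$ is the Levi-Civita connection of $\overline g$. Assume that $(M,g)$ is complete, non-compact and oriented, and that $f\in L^1(I)$. Let $t_0\in I$. Say that $\psi(M)$ is asymptotic to $\{t_0\}\times F$ at infinity if $\tau(p)\to t_0$ as $d_g(p,o)\to+\infty$, where $d_g$ is the Riemannian distance of $(M,g)$ and $o\in M$ is a fixed point. (i) If $\overline g(\overrightarrow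 H,\partial_t)\le \dfrac{f'(\tau)}{f(\tau)}$ on $M$, $\psi(M)$ is below the slice $\{t_0\}\times F$ (that is, $\tau\le t_0$ on $M$) and asymptotic to it at infinity, then $\psi(M)\subseteq\{t_0\}\times F$. (ii) If $\overline g(\overrightarrow H,\partial_t)\ge \dfrac{f'(\tau)}{f(\tau)}$ on $M$, $\psi(M)$ is above the slice $\{t_0\}\times F$ (that is, $\tau\ge t_0$ on $M$) and asymptotic to it at infinity, then $\psi(M)\subseteq\{t_0\}\times F$. -/

import Mathlib

open scoped Manifold ContDiff Topology
open Bundle Filter MeasureTheory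

noncomputable section

namespace GRW

/-! ### Pseudo-Riemannian metrics in charts, Levi-Civita connection -/

section PseudoRiemannian

variable {E : Type*} [NormedAddCommGroup E] [NormedSpace ℝ E]

/-- The Christoffel symbols of the first kind at `y` of a metric `B` on (an open subset of) the
vector space `E`, as a linear form: for the constant vector fields `u, v, w`,
`B (∇_u v, w) = (1/2) (D_u (B(v,w)) + D_v (B(u,w)) - D_w (B(u,v)))` (Koszul formula). -/
def christoffelLower (B : E → E →L[ℝ] E →L[ℝ] ℝ) (y u v : E) : E →L[ℝ] ℝ :=
  (1 / 2 : ℝ) • (fderiv ℝ B y u v + fderiv ℝ B y v u - ((fderiv ℝ B y).flip u).flip v)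

/-- The Christoffel symbols `Γ_y(u,v)` (of the second kind): the vector metrically equivalent to
the linear form `christoffelLower B y u v`; here `B y : E →L[ℝ] (E →L[ℝ] ℝ)` lowers the index, and
it is invertible when `B y` is nondegenerate and `E` is finite-dimensional. -/
def christoffel (B : E → E →L[ℝ] E →L[ℝ] ℝ) (y u v : E) : E :=
  (B y).inverse (christoffelLower B y u v)

variable {H : Type*} [TopologicalSpace H] (J : ModelWithCorners ℝ E H)
  {N : Type*} [TopologicalSpace N] [ChartedSpace H N]

/-- The expression of a metric tensor `G` on `N` in the preferred chart at `q`: its pull-back by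
the inverse of this chart. -/
def chartMetric (G : ∀ x : N, TangentSpace J x →L[ℝ] TangentSpace J x →L[ℝ] ℝ) (q : N) (y : E) :
    E →L[ℝ] E →L[ℝ] ℝ :=
  let D : E →L[ℝ] TangentSpace J ((extChartAt J q).symm y) :=
    mfderiv 𝓘(ℝ, E) J (extChartAt J q).symm y
  (D.precomp ℝ).comp ((G ((extChartAt J q).symm y)).comp D)

end PseudoRiemannian

/-! ### Second fundamental form and mean curvature vector of an isometric immersion -/

section Submanifold

variable {E : Type*} [NormedAddCommGroup E] [NormedSpace ℝ E]
  {H : Type*} [TopologicalSpace H] (J : ModelWithCorners ℝ E H)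
  {N : Type*} [TopologicalSpace N] [ChartedSpace H N]
  {k : ℕ} {M : Type*} [TopologicalSpace M] [ChartedSpace (EuclideanSpace ℝ (Fin k)) M]

/-- The covariant derivative `∇̄_X (dψ Y)` at `ψ p`, for the Levi-Civita connection of the metric
`G` on `N`, where `Y` is extended near `p` with constant coefficients in the preferred chart of `M`
at `p`. In the preferred charts at `p` and `ψ p` (which identify `T_p M` and `T_{ψ p} N` with the
model vector spaces) it is `D²ψ(X, Y) + Γ(dψ X, dψ Y)`. The normal part does not depend on the
extension of `Y`. -/
def covDerivAlong (G : ∀ x : N, TangentSpace J x →L[ℝ] TangentSpace J x →L[ℝ] ℝ) (ψ : M → N)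
    (p : M) (X Y : TangentSpace (𝓡 k) p) : TangentSpace J (ψ p) :=
  let ψ' : EuclideanSpace ℝ (Fin k) → E := writtenInExtChartAt (𝓡 k) J p ψ
  let y : EuclideanSpace ℝ (Fin k) := extChartAt (𝓡 k) p p
  (fderiv ℝ (fderiv ℝ ψ') y X Y
    + christoffel (chartMetric J G (ψ p)) (ψ' y) (fderiv ℝ ψ' y X) (fderiv ℝ ψ' y Y) : E)

variable [RiemannianBundle (fun p : M ↦ TangentSpace (𝓡 k) p)]

instance (p : M) : FiniteDimensional ℝ (TangentSpace (𝓡 k) p) :=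
  inferInstanceAs (FiniteDimensional ℝ (EuclideanSpace ℝ (Fin k)))

/-- An orthonormal basis of `T_p M` for the Riemannian metric of `M`. -/
def onb (k : ℕ) {M : Type*} [TopologicalSpace M] [ChartedSpace (EuclideanSpace ℝ (Fin k)) M]
    [RiemannianBundle (fun p : M ↦ TangentSpace (𝓡 k) p)] (p : M) :
    OrthonormalBasis (Fin (Module.finrank ℝ (TangentSpace (𝓡 k) p))) ℝ (TangentSpace (𝓡 k) p) :=
  stdOrthonormalBasis ℝ (TangentSpace (𝓡 k) p)

/-- The component `Z^⊥` of `Z ∈ T_{ψ p} N` normal to `ψ`, when the metric of `M` is the one induced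
by `ψ`: `Z^⊥ = Z - ∑ i, G(Z, dψ E_i) dψ E_i` for an orthonormal basis `E_i` of `T_p M`. -/
def normalPart (G : ∀ x : N, TangentSpace J x →L[ℝ] TangentSpace J x →L[ℝ] ℝ) (ψ : M → N)
    (p : M) (Z : TangentSpace J (ψ p)) : TangentSpace J (ψ p) :=
  Z - ∑ i, G (ψ p) Z (mfderiv (𝓡 k) J ψ p (onb k p i)) • mfderiv (𝓡 k) J ψ p (onb k p i)

/-- The second fundamental form, with the sign convention of General Relativity:
`II(X, Y) = -(∇̄_X Y)^⊥`. -/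
def secondFundamentalForm (G : ∀ x : N, TangentSpace J x →L[ℝ] TangentSpace J x →L[ℝ] ℝ)
    (ψ : M → N) (p : M) (X Y : TangentSpace (𝓡 k) p) : TangentSpace J (ψ p) :=
  -normalPart (k := k) J G ψ p (covDerivAlong J G ψ p X Y)

/-- The mean curvature vector `(1/k) trace II`. -/
def meanCurvature (G : ∀ x : N, TangentSpace J x →L[ℝ] TangentSpace J x →L[ℝ] ℝ)
    (ψ : M → N) (p : M) : TangentSpace J (ψ p) :=
  (k : ℝ)⁻¹ • ∑ i, secondFundamentalForm J G ψ p (onb k p i) (onb k p i)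

end Submanifold

/-! ### Generalized Robertson-Walker spacetimes

The spacetime `I ×_f F` is the open subset `{q | q.1 ∈ I}` of the product manifold `ℝ × F`. -/

section Spacetime

/-- The model with corners of the product manifold `ℝ × F`, for `F` of dimension `m`. -/
abbrev stModel (m : ℕ) : ModelWithCorners ℝ (ℝ × EuclideanSpace ℝ (Fin m))
    (ModelProd ℝ (EuclideanSpace ℝ (Fin m))) :=
  𝓘(ℝ, ℝ).prod (𝓡 m)

variable {m : ℕ} {F : Type*} [TopologicalSpace F] [ChartedSpace (EuclideanSpace ℝ (Fin m)) F]

/-- The coordinate vector field `∂_t` on `ℝ × F`. -/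
def timeField (q : ℝ × F) : TangentSpace (stModel m) q :=
  ((1, 0) : ℝ × EuclideanSpace ℝ (Fin m))

variable [RiemannianBundle (fun x : F ↦ TangentSpace (𝓡 m) x)]

/-- The Lorentzian metric `-dt² + f(t)² g_F` at the point `q`. -/
def metric (f : ℝ → ℝ) (q : ℝ × F) :
    TangentSpace (stModel m) q →L[ℝ] TangentSpace (stModel m) q →L[ℝ] ℝ :=
  let dt : TangentSpace (stModel m) q →L[ℝ] ℝ :=
    mfderiv (stModel m) 𝓘(ℝ, ℝ) (Prod.fst : ℝ × F → ℝ) q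
  let dF : TangentSpace (stModel m) q →L[ℝ] TangentSpace (𝓡 m) q.2 :=
    mfderiv (stModel m) (𝓡 m) (Prod.snd : ℝ × F → F) q
  let gF : TangentSpace (𝓡 m) q.2 →L[ℝ] TangentSpace (𝓡 m) q.2 →L[ℝ] ℝ := innerSL ℝ
  (-(dt.precomp ℝ).comp ((ContinuousLinearMap.mul ℝ ℝ).comp dt)) +
    (f q.1) ^ 2 • (dF.precomp ℝ).comp (gF.comp dF)

variable {k : ℕ} {M : Type*}

/-- `ψ` is a smooth spacelike immersion of `M` into `I ×_f F`. (The last field implies that the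
differential of `ψ` is injective at every point.) -/
structure IsSpacelikeImmersion [TopologicalSpace M] [ChartedSpace (EuclideanSpace ℝ (Fin k)) M]
    (I : Set ℝ) (f : ℝ → ℝ) (ψ : M → ℝ × F) : Prop where
  mem : ∀ p, (ψ p).1 ∈ I
  contMDiff : ContMDiff (𝓡 k) (stModel m) ∞ ψ
  spacelike : ∀ (p : M) (v : TangentSpace (𝓡 k) p), v ≠ 0 →
    0 < metric f (ψ p) (mfderiv (𝓡 k) (stModel m) ψ p v) (mfderiv (𝓡 k) (stModel m) ψ p v)

/-- The Riemannian metric of `M` is the one induced by `ψ` from the spacetime metric. -/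
def IsInducedMetric [TopologicalSpace M] [ChartedSpace (EuclideanSpace ℝ (Fin k)) M]
    [RiemannianBundle (fun p : M ↦ TangentSpace (𝓡 k) p)] (f : ℝ → ℝ) (ψ : M → ℝ × F) : Prop :=
  ∀ (p : M) (v w : TangentSpace (𝓡 k) p), inner ℝ v w =
    metric f (ψ p) (mfderiv (𝓡 k) (stModel m) ψ p v) (mfderiv (𝓡 k) (stModel m) ψ p w)

end Spacetime

/-- `ψ(M)` is asymptotic at infinity to the slice `{t₀} × F`: the height function `π_I ∘ ψ` tends
to `t₀` as the distance in `M` to a fixed origin tends to infinity. -/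
def IsAsymptoticToSlice {M F : Type*} [MetricSpace M] (ψ : M → ℝ × F) (t₀ : ℝ) : Prop :=
  ∃ o : M, Tendsto (fun p ↦ (ψ p).1) (comap (fun p ↦ dist p o) atTop) (𝓝 t₀)

end GRW

end

/-! Everything rests on one formula. Write τ for the height function and H for the mean curvature
vector. Tracing the normal part of the ambient covariant derivative against ∂_t gives k ḡ(H, ∂_t) =
Δτ + (f'/f)(τ) (k + |∇τ|²). The comparison of ḡ(H, ∂_t) with f'/f cancels the term k f'/f. What
remains is Δτ ≤ -(f'/f)(τ)|∇τ|² in case (i), and Δ(-τ) ≤ (f'/f)(τ)|∇τ|² in case (ii). So u = τ or u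
= -τ satisfies Δu ≤ c|∇u|² with c continuous, and such a function obeys Hopf's strong minimum
principle.

By Hopf-Rinow (`IsRiemannianManifold.properSpace`), going to infinity in distance means leaving
every compact set. If u were somewhere below its limit at infinity, it would attain a minimum. The
set of minimum points is closed, open by the strong principle (`eventually_eq_of_laplacian_le`), and
M is connected, so u is constant. As M is noncompact, the constant equals the limit, a
contradiction. Hence u is at least its limit (`le_of_laplacian_le_of_tendsto`), and the one-sided
assumption on τ gives equality.

The geometry is done in charts with lowered Christoffel symbols. `christoffelLower_pullback` serves
twice: for a transition map it makes the Laplacian independent of the chart, and for ψ it identifies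
the tangential part of the ambient derivative with the intrinsic connection
(`laplacianInFrame_height`). -/

noncomputable section

/-! ### Completeness and properness of Riemannian manifolds -/

section HopfRinow

/-- A complete locally compact metric space in which points can be interpolated up to an arbitrarily
small error is proper. -/
theorem properSpace_of_complete_of_interpolation {X : Type*} [MetricSpace X] [CompleteSpace X]
    [LocallyCompactSpace X]
    (hX : ∀ (x y : X) (r s : ℝ), 0 ≤ r → 0 < s → dist x y < r + s →
      ∃ z, dist x z ≤ r ∧ dist z y < s) : ProperSpace X := by
  refine ⟨fun o r₀ ↦ ?_⟩
  by_contra hr₀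
  set S : Set ℝ := {r | IsCompact (Metric.closedBall o r)} with hS
  have hdown : ∀ r ∈ S, ∀ r' ≤ r, r' ∈ S := fun r hr r' hr' ↦
    hr.of_isClosed_subset Metric.isClosed_closedBall (Metric.closedBall_subset_closedBall hr')
  have hbdd : BddAbove S := ⟨r₀, fun r hr ↦ by
    by_contra h
    exact hr₀ (hdown r hr r₀ (not_le.1 h).le)⟩
  have h0 : (0 : ℝ) ∈ S := by simp [hS]
  set R := sSup S with hR
  have hR0 : 0 ≤ R := le_csSup hbdd h0
  have hlt : ∀ r < R, r ∈ S := fun r hr ↦ by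
    obtain ⟨r', hr', h⟩ := exists_lt_of_lt_csSup ⟨0, h0⟩ hr
    exact hdown r' hr' r h.le
  -- The supremum is attained: every point of the ball of radius R is close to a slightly smaller
  -- ball, already known to be compact.
  have hRS : R ∈ S := by
    refine isCompact_iff_totallyBounded_isComplete.2 ⟨?_, Metric.isClosed_closedBall.isComplete⟩
    rw [Metric.totallyBounded_iff]
    intro ε hε
    -- The maximum with 0 keeps the interpolation radius nonnegative; the gap ε/4 is less than the
    -- step ε/2, as the strict inequality in `hX` requires.
    have hrS : max (R - ε / 4) 0 ∈ S := by
      rcases le_total (R - ε / 4) 0 with h | h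
      · simpa [max_eq_right h] using h0
      · rw [max_eq_left h]; exact hlt _ (by linarith)
    obtain ⟨t, ht, hcov⟩ := Metric.totallyBounded_iff.1 hrS.totallyBounded (ε / 2) (by linarith)
    refine ⟨t, ht, fun y hy ↦ ?_⟩
    obtain ⟨z, hz, hzy⟩ := hX o y (max (R - ε / 4) 0) (ε / 2) (le_max_right _ _) (by linarith) (by
      rw [dist_comm]
      have := Metric.mem_closedBall.1 hy
      have := le_max_left (R - ε / 4) 0
      linarith)
    have := hcov (Metric.mem_closedBall'.2 hz)
    simp only [Set.mem_iUnion, Metric.mem_ball, exists_prop] at this ⊢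
    obtain ⟨w, hw, hzw⟩ := this
    exact ⟨w, hw, by linarith [dist_triangle y z w, dist_comm z y]⟩
  have hRc : IsCompact (Metric.closedBall o R) := hRS
  -- Local compactness makes a thickening of the compact ball compact. It contains the ball of
  -- radius R + δ/2, which contradicts the choice of R.
  obtain ⟨δ, hδ, hcomp⟩ := hRc.exists_isCompact_cthickening
  have : R + δ / 2 ∈ S := by
    refine hcomp.of_isClosed_subset Metric.isClosed_closedBall fun y hy ↦ ?_
    obtain ⟨z, hz, hzy⟩ := hX o y R δ hR0 hδ (by
      have := Metric.mem_closedBall'.1 hy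
      linarith)
    exact Metric.mem_cthickening_of_dist_le y z δ _ (Metric.mem_closedBall'.2 hz)
      (by rw [dist_comm]; exact hzy.le)
  linarith [le_csSup hbdd this]

variable {E : Type*} [NormedAddCommGroup E] [NormedSpace ℝ E]
  {H : Type*} [TopologicalSpace H] {I : ModelWithCorners ℝ E H}
  {M : Type*} [MetricSpace M] [ChartedSpace H M]
  [RiemannianBundle (fun x : M ↦ TangentSpace I x)]

variable (I) in
/-- Interpolation of points in a Riemannian manifold. -/
theorem IsRiemannianManifold.exists_interpolation [IsRiemannianManifold I M] (x y : M) (r s : ℝ)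
    (hr : 0 ≤ r) (hs : 0 < s) (h : dist x y < r + s) : ∃ z, dist x z ≤ r ∧ dist z y < s := by
  rcases le_or_gt (dist x y) r with hxy | hxy
  · exact ⟨y, hxy, by simpa using hs⟩
  have h' : Manifold.riemannianEDist I x y < ENNReal.ofReal (r + s) := by
    rw [← IsRiemannianManifold.out (I := I) x y, edist_dist]
    exact (ENNReal.ofReal_lt_ofReal_iff (by linarith)).2 h
  obtain ⟨γ, γ0, γ1, hγ, hlen⟩ := Manifold.exists_lt_of_riemannianEDist_lt h'
  -- On a path shorter than r + s, take a point at distance exactly r from x. The arc before it has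
  -- length at least r, so less than s is left for the arc after it.
  have hcont : ContinuousOn (fun t ↦ dist x (γ t)) (Set.Icc 0 1) :=
    (continuous_const.dist continuous_id).comp_continuousOn hγ.continuousOn
  obtain ⟨t, ht, htr⟩ := intermediate_value_Icc zero_le_one hcont
    (show r ∈ Set.Icc (dist x (γ 0)) (dist x (γ 1)) by rw [γ0, γ1, dist_self]; exact ⟨hr, hxy.le⟩)
  refine ⟨γ t, htr.le, ?_⟩
  have h1 : ENNReal.ofReal r ≤ Manifold.pathELength I γ 0 t := by
    rw [← htr, ← edist_dist, IsRiemannianManifold.out (I := I) x (γ t)]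
    exact Manifold.riemannianEDist_le_pathELength
      (hγ.mono (Set.Icc_subset_Icc_right ht.2)) γ0 rfl ht.1
  have h2 : edist (γ t) y ≤ Manifold.pathELength I γ t 1 := by
    rw [IsRiemannianManifold.out (I := I) (γ t) y]
    exact Manifold.riemannianEDist_le_pathELength
      (hγ.mono (Set.Icc_subset_Icc_left ht.1)) rfl γ1 ht.2
  rw [← Manifold.pathELength_add ht.1 ht.2, ENNReal.ofReal_add hr hs.le] at hlen
  have h3 : ENNReal.ofReal r + edist (γ t) y < ENNReal.ofReal r + ENNReal.ofReal s :=
    (add_le_add h1 h2).trans_lt hlen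
  have h4 := (ENNReal.add_lt_add_iff_left ENNReal.ofReal_ne_top).1 h3
  rwa [edist_dist, ENNReal.ofReal_lt_ofReal_iff hs] at h4

variable (I M) in
/-- Hopf-Rinow: a complete locally compact Riemannian manifold is proper. -/
theorem IsRiemannianManifold.properSpace [LocallyCompactSpace H]
    [IsRiemannianManifold I M] [CompleteSpace M] : ProperSpace M :=
  have : LocallyCompactSpace M := ChartedSpace.locallyCompactSpace H M
  properSpace_of_complete_of_interpolation (IsRiemannianManifold.exists_interpolation I)

end HopfRinow

namespace GRW

/-! ### The strong maximum principle in a chart -/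

section MaximumPrinciple

/-- Second order necessary condition at a local minimum. -/
theorem _root_.IsLocalMin.fderiv_fderiv_nonneg {E : Type*} [NormedAddCommGroup E] [NormedSpace ℝ E]
    {h : E → ℝ} {q : E} (hq : IsLocalMin h q) (hh : ContDiffAt ℝ 2 h q) (e : E) :
    0 ≤ fderiv ℝ (fderiv ℝ h) q e e := by
  set ℓ : ℝ → E := fun t ↦ q + t • e with hℓ
  have hℓ0 : ℓ 0 = q := by simp [hℓ]
  have hℓd : ∀ t, HasDerivAt ℓ e t := fun t ↦
    (((hasDerivAt_id t).smul_const e).const_add q).congr_deriv (one_smul ℝ e)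
  have hℓc : Tendsto ℓ (𝓝 0) (𝓝 q) := by
    have := (hℓd 0).continuousAt.tendsto
    rwa [hℓ0] at this
  have hev : ∀ᶠ y in 𝓝 q, DifferentiableAt ℝ h y :=
    (hh.eventually (by simp)).mono fun y hy ↦ hy.differentiableAt (by norm_num)
  have hd1 : deriv (h ∘ ℓ) =ᶠ[𝓝 0] fun t ↦ fderiv ℝ h (ℓ t) e := by
    filter_upwards [hℓc.eventually hev] with t ht
    exact (ht.hasFDerivAt.comp_hasDerivAt t (hℓd t)).deriv
  have hd2 : HasFDerivAt (fderiv ℝ h) (fderiv ℝ (fderiv ℝ h) q) (ℓ 0) := by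
    rw [hℓ0]
    exact ((hh.fderiv_right (m := 1) (by norm_num)).differentiableAt (by norm_num)).hasFDerivAt
  have hdd : deriv (deriv (h ∘ ℓ)) 0 = fderiv ℝ (fderiv ℝ h) q e e := by
    rw [hd1.deriv_eq]
    have := (hd2.comp_hasDerivAt 0 (hℓd 0)).clm_apply (hasDerivAt_const (0 : ℝ) e)
    simpa using this.deriv
  have hmin : IsLocalMin (h ∘ ℓ) 0 := by
    have : ∀ᶠ t in 𝓝 (0 : ℝ), h q ≤ h (ℓ t) := hℓc.eventually hq
    simpa [IsLocalMin, IsMinFilter, hℓ0] using this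
  by_contra hneg
  rw [not_le, ← hdd] at hneg
  have hcont : ContinuousAt (h ∘ ℓ) 0 :=
    ContinuousAt.comp (by rw [hℓ0]; exact hh.continuousAt) (hℓd 0).continuousAt
  -- A negative second derivative would make the minimum also a local maximum, so the function would
  -- be locally constant along the line and its second derivative zero.
  have hmax := isLocalMax_of_deriv_deriv_neg hneg hmin.deriv_eq_zero hcont
  have hconst : (h ∘ ℓ) =ᶠ[𝓝 0] fun _ ↦ (h ∘ ℓ) 0 := by
    filter_upwards [hmin, hmax] with t h1 h2 using le_antisymm h2 h1
  have h1 : deriv (h ∘ ℓ) =ᶠ[𝓝 0] fun _ ↦ 0 := by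
    simpa using hconst.deriv
  rw [h1.deriv_eq] at hneg
  simp at hneg

variable {E : Type*} [NormedAddCommGroup E] [NormedSpace ℝ E] {ι : Type*} [Fintype ι]

/-- `e` is an orthonormal basis for the symmetric bilinear form `b`. -/
structure IsOrthonormalFrame [DecidableEq ι] (b : E →L[ℝ] E →L[ℝ] ℝ) (e : ι → E) : Prop where
  orthonormal : ∀ i j, b (e i) (e j) = if i = j then 1 else 0
  expansion : ∀ v, ∑ i, b v (e i) • e i = v

/-- The Laplace-Beltrami operator of the metric `B` at `y`, computed in an orthonormal basis `e` of
`B y`. -/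
def laplacianInFrame (B : E → E →L[ℝ] E →L[ℝ] ℝ) (y : E) (e : ι → E) (φ : E → ℝ) : ℝ :=
  ∑ i, (fderiv ℝ (fderiv ℝ φ) y (e i) (e i) -
    ∑ j, christoffelLower B y (e i) (e i) (e j) * fderiv ℝ φ y (e j))

/-- The gradient term carries a² and the Laplacian only a. For |a| large the former dominates
wherever dφ ≠ 0; this is what makes the exponential a Hopf barrier. -/
theorem laplacianInFrame_exp {B : E → E →L[ℝ] E →L[ℝ] ℝ} {y : E} {e : ι → E} {φ : E → ℝ}
    (hφ : ContDiffAt ℝ 2 φ y) (a : ℝ) :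
    laplacianInFrame B y e (fun z ↦ Real.exp (a * φ z)) =
      Real.exp (a * φ y) *
        (a ^ 2 * ∑ i, fderiv ℝ φ y (e i) ^ 2 + a * laplacianInFrame B y e φ) := by
  have hev : ∀ᶠ z in 𝓝 y, DifferentiableAt ℝ φ z :=
    (hφ.eventually (by simp)).mono fun z hz ↦ hz.differentiableAt (by norm_num)
  have hd : ∀ z, DifferentiableAt ℝ φ z →
      HasFDerivAt (fun z ↦ Real.exp (a * φ z)) (Real.exp (a * φ z) • (a • fderiv ℝ φ z)) z :=
    fun z hz ↦ (hz.hasFDerivAt.const_mul a).exp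
  have hd1 : fderiv ℝ (fun z ↦ Real.exp (a * φ z)) =ᶠ[𝓝 y]
      fun z ↦ Real.exp (a * φ z) • (a • fderiv ℝ φ z) :=
    hev.mono fun z hz ↦ (hd z hz).fderiv
  have h2 : HasFDerivAt (fderiv ℝ φ) (fderiv ℝ (fderiv ℝ φ) y) y :=
    ((hφ.fderiv_right (m := 1) (by norm_num)).differentiableAt (by norm_num)).hasFDerivAt
  have hd2 := ((hd y hev.self_of_nhds).smul (h2.const_smul a)).fderiv
  simp only [laplacianInFrame, hd1.fderiv_eq, hd1.self_of_nhds]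
  erw [hd2]
  simp only [add_apply, smul_apply, Pi.smul_apply,
    ContinuousLinearMap.smulRight_apply, smul_eq_mul, Finset.mul_sum, ← Finset.sum_add_distrib,
    mul_add, mul_sub]
  refine Finset.sum_congr rfl fun i _ ↦ ?_
  have : ∀ j, christoffelLower B y (e i) (e i) (e j) *
      (Real.exp (a * φ y) * (a * fderiv ℝ φ y (e j))) = Real.exp (a * φ y) *
      (a * (christoffelLower B y (e i) (e i) (e j) * fderiv ℝ φ y (e j))) := fun j ↦ by ring
  simp only [this, ← Finset.mul_sum]
  ring

variable {V : Type*} [NormedAddCommGroup V] [InnerProductSpace ℝ V]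

theorem hasFDerivAt_norm_sub_sq (x y : V) :
    HasFDerivAt (fun z ↦ ‖z - x‖ ^ 2) ((2 : ℝ) • innerSL ℝ (y - x)) y := by
  have := (hasStrictFDerivAt_norm_sq (y - x)).hasFDerivAt.comp y ((hasFDerivAt_id y).sub_const x)
  refine this.congr_fderiv ?_
  ext v
  simp

theorem fderiv_norm_sub_sq (x : V) :
    fderiv ℝ (fun z ↦ ‖z - x‖ ^ 2) = fun y ↦ (2 : ℝ) • innerSL ℝ (y - x) :=
  funext fun y ↦ (hasFDerivAt_norm_sub_sq x y).fderiv

theorem fderiv_fderiv_norm_sub_sq (x y v w : V) :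
    fderiv ℝ (fderiv ℝ (fun z ↦ ‖z - x‖ ^ 2)) y v w = 2 * inner ℝ v w := by
  rw [fderiv_norm_sub_sq]
  have : HasFDerivAt (fun y ↦ (2 : ℝ) • innerSL ℝ (y - x))
      ((2 : ℝ) • (innerSL ℝ : V →L[ℝ] V →L[ℝ] ℝ)) y :=
    ((((innerSL ℝ : V →L[ℝ] V →L[ℝ] ℝ).hasFDerivAt).comp y
      ((hasFDerivAt_id y).sub_const x)).const_smul (2 : ℝ))
  rw [this.fderiv]
  simp only [smul_apply, smul_eq_mul]
  rfl

theorem contDiff_norm_sub_sq (x : V) {n : WithTop ℕ∞} : ContDiff ℝ n (fun z : V ↦ ‖z - x‖ ^ 2) :=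
  (contDiff_id.sub contDiff_const).norm_sq ℝ

/-- The set of orthonormal frames of a metric over a compact set is compact. -/
theorem isCompact_orthonormalFrames [FiniteDimensional ℝ V] [DecidableEq ι]
    {B : V → V →L[ℝ] V →L[ℝ] ℝ} {K : Set V} (hK : IsCompact K) (hB : ContinuousOn B K)
    (hpos : ∀ y ∈ K, ∀ v, v ≠ 0 → 0 < B y v v) :
    IsCompact {z : V × (ι → V) | z.1 ∈ K ∧ IsOrthonormalFrame (B z.1) z.2} := by
  have hcl : IsClosed {z : V × (ι → V) | z.1 ∈ K ∧ IsOrthonormalFrame (B z.1) z.2} := by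
    have hK' : IsClosed {z : V × (ι → V) | z.1 ∈ K} := hK.isClosed.preimage continuous_fst
    have hB' : ContinuousOn (fun z : V × (ι → V) ↦ B z.1) {z | z.1 ∈ K} :=
      hB.comp continuousOn_fst fun z hz ↦ hz
    -- Both frame conditions are preimages of a single point of a product space under a map
    -- continuous over K.
    have : {z : V × (ι → V) | z.1 ∈ K ∧ IsOrthonormalFrame (B z.1) z.2} =
        ({z : V × (ι → V) | z.1 ∈ K} ∩ (fun z i j ↦ B z.1 (z.2 i) (z.2 j)) ⁻¹'
          {fun i j ↦ if i = j then (1 : ℝ) else 0}) ∩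
        ({z : V × (ι → V) | z.1 ∈ K} ∩ (fun z v ↦ ∑ i, B z.1 v (z.2 i) • z.2 i) ⁻¹' {id}) := by
      ext z
      simp only [Set.mem_ofPred_eq, Set.mem_inter_iff, Set.mem_preimage, Set.mem_singleton_iff,
        funext_iff, id]
      exact ⟨fun h ↦ ⟨⟨h.1, h.2.1⟩, h.1, h.2.2⟩, fun h ↦ ⟨h.1.1, h.1.2, h.2.2⟩⟩
    rw [this]
    refine (ContinuousOn.preimage_isClosed_of_isClosed ?_ hK' isClosed_singleton).inter
      (ContinuousOn.preimage_isClosed_of_isClosed ?_ hK' isClosed_singleton)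
    · refine continuousOn_pi.2 fun i ↦ continuousOn_pi.2 fun j ↦ ?_
      exact (hB'.clm_apply (by fun_prop)).clm_apply (by fun_prop)
    · refine continuousOn_pi.2 fun v ↦ continuousOn_finsetSum _ fun i _ ↦ ?_
      exact ((hB'.clm_apply continuousOn_const).clm_apply (by fun_prop)).smul (by fun_prop)
  -- Uniform ellipticity over K bounds the frames: c‖e i‖² ≤ B(e i, e i) = 1. The radius c⁻¹ + 1
  -- used below avoids a square root.
  obtain ⟨c, hc, hcB⟩ : ∃ c > 0, ∀ y ∈ K, ∀ v, c * ‖v‖ ^ 2 ≤ B y v v := by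
    have hcomp : IsCompact (K ×ˢ Metric.sphere (0 : V) 1) := hK.prod (isCompact_sphere _ _)
    have hcont : ContinuousOn (fun z : V × V ↦ B z.1 z.2 z.2) (K ×ˢ Metric.sphere (0 : V) 1) :=
      ((hB.comp continuousOn_fst fun z hz ↦ hz.1).clm_apply continuousOn_snd).clm_apply
        continuousOn_snd
    obtain ⟨c, hc, hcB⟩ := hcomp.exists_forall_le' hcont (a := 0) (fun z hz ↦ hpos _ hz.1 _ (by
      rintro h0
      have := hz.2
      simp [h0] at this))
    refine ⟨c, hc, fun y hy v ↦ ?_⟩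
    rcases eq_or_ne v 0 with rfl | hv
    · simp
    have hv' : ‖v‖ ≠ 0 := norm_ne_zero_iff.2 hv
    have := hcB (y, ‖v‖⁻¹ • v) ⟨hy, by simp [norm_smul, hv']⟩
    simp only [map_smul, smul_apply, smul_eq_mul] at this
    calc c * ‖v‖ ^ 2 ≤ (‖v‖⁻¹ * (‖v‖⁻¹ * B y v v)) * ‖v‖ ^ 2 := by gcongr
      _ = B y v v := by field_simp
  refine ((hK.prod (isCompact_closedBall (0 : ι → V) (c⁻¹ + 1)))).of_isClosed_subset hcl ?_
  rintro ⟨y, e⟩ ⟨hy, he⟩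
  refine ⟨hy, ?_⟩
  rw [mem_closedBall_zero_iff, pi_norm_le_iff_of_nonneg (by positivity)]
  intro i
  have h1 := hcB y hy (e i)
  have h2 : B y (e i) (e i) = 1 := by simpa using he.orthonormal i i
  have h3 : ‖e i‖ ^ 2 ≤ c⁻¹ := by
    rw [← one_div, le_div_iff₀ hc]
    linarith
  nlinarith [sq_nonneg (‖e i‖ - 1), norm_nonneg (e i)]

set_option maxSynthPendingDepth 5 in
/-- Hopf's strong maximum principle, in a chart: a function satisfying `Δ u ≤ c |∇ u|²` which
attains its minimum is locally constant there. -/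
theorem eventually_eq_of_laplacianInFrame_le [FiniteDimensional ℝ V] [DecidableEq ι]
    {U : Set V} (hU : IsOpen U) {B : V → V →L[ℝ] V →L[ℝ] ℝ} (hB : ContDiffOn ℝ 1 B U)
    (hpos : ∀ y ∈ U, ∀ v, v ≠ 0 → 0 < B y v v) {u c : V → ℝ} (hu : ContDiffOn ℝ 2 u U)
    (hc : ContinuousOn c U)
    (hlap : ∀ y ∈ U, ∃ e : ι → V, IsOrthonormalFrame (B y) e ∧
      laplacianInFrame B y e u ≤ c y * ∑ i, fderiv ℝ u y (e i) ^ 2)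
    {z₀ : V} (hz₀ : z₀ ∈ U) (hmin : ∀ y ∈ U, u z₀ ≤ u y) : ∀ᶠ y in 𝓝 z₀, u y = u z₀ := by
  -- The factor 2 leaves room: the minimum point nearest to some x₁ within r of z₀ lies within r of
  -- x₁, hence strictly within 2r of z₀.
  obtain ⟨r, hr, hrU⟩ : ∃ r > 0, Metric.closedBall z₀ (2 * r) ⊆ U := by
    obtain ⟨s, hs, h⟩ := Metric.nhds_basis_closedBall.mem_iff.1 (hU.mem_nhds hz₀)
    exact ⟨s / 2, by linarith, by rwa [mul_div_cancel₀ s two_ne_zero]⟩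
  by_contra hcon
  obtain ⟨x₁, hx₁, hx₁u⟩ : ∃ x ∈ Metric.ball z₀ r, u x ≠ u z₀ := by
    by_contra! h
    exact hcon (Filter.mem_of_superset (Metric.ball_mem_nhds z₀ hr) h)
  -- the nearest point `z` to `x₁` of the minimum set
  set Z : Set V := Metric.closedBall z₀ (2 * r) ∩ u ⁻¹' {u z₀} with hZ
  have hZc : IsCompact Z := by
    refine (isCompact_closedBall z₀ (2 * r)).of_isClosed_subset ?_ Set.inter_subset_left
    exact (hu.continuousOn.mono hrU).preimage_isClosed_of_isClosed Metric.isClosed_closedBall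
      isClosed_singleton
  obtain ⟨z, hzZ, hzmin⟩ := hZc.exists_isMinOn ⟨z₀, by simp [hZ]; linarith⟩
    (f := fun y ↦ dist y x₁) (by fun_prop)
  have hzmin' : ∀ y ∈ Z, dist z x₁ ≤ dist y x₁ := fun y hy ↦ hzmin hy
  have hzr : dist z x₁ < r := (hzmin' z₀ (by simp [hZ]; linarith)).trans_lt
    (by rw [dist_comm]; exact hx₁)
  have hzz₀ : dist z z₀ < 2 * r := by
    have := dist_triangle z x₁ z₀
    have := Metric.mem_ball.1 hx₁
    linarith
  have hzx₁ : z ≠ x₁ := fun h ↦ hx₁u (h ▸ hzZ.2)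
  -- a ball centred at `x` whose closure meets the minimum set at `z` only
  set x : V := (2 : ℝ)⁻¹ • (x₁ + z) with hx
  have hbx : x - x₁ = z - x := by rw [hx]; module
  have hzx : z - x ≠ 0 := by
    intro h
    apply hzx₁
    have h1 : z - x₁ = (2 : ℝ) • (z - x) := by rw [hx]; module
    rw [h, smul_zero] at h1
    exact sub_eq_zero.1 h1
  -- The ball about the midpoint x is internally tangent at z to the ball about x₁ through z, whose
  -- interior contains no point of Z. The parallelogram law, a form of strict convexity, gives
  -- uniqueness of the contact point.
  have htouch : ∀ y ∈ Z, ‖y - x‖ ≤ ‖z - x‖ → y = z := by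
    intro y hy hyx
    have h1 := hzmin' y hy
    have h2 : dist z x₁ = 2 * ‖z - x‖ := by
      rw [dist_eq_norm, show z - x₁ = (2 : ℝ) • (z - x) by rw [hx]; module, norm_smul]
      simp
    have h3 : dist y x₁ = ‖(y - x) + (z - x)‖ := by
      rw [dist_eq_norm, ← hbx]; congr 1; abel
    have h4 := parallelogram_law_with_norm ℝ (y - x) (z - x)
    rw [h2, h3] at h1
    have h5 : ‖(y - x) - (z - x)‖ = 0 := by
      have := norm_nonneg (y - x)
      have := norm_nonneg (z - x)
      have := norm_nonneg ((y - x) - (z - x))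
      nlinarith
    simpa [sub_eq_zero] using h5
  -- Excluding x keeps the gradient of ‖y - x‖² away from zero on K.
  obtain ⟨ρ, hρ, hρsub⟩ : ∃ ρ > 0, Metric.closedBall z ρ ⊆
      Metric.closedBall z₀ (2 * r) ∩ {x}ᶜ := by
    refine Metric.nhds_basis_closedBall.mem_iff.1 (Filter.inter_mem ?_ ?_)
    · exact Filter.mem_of_superset (Metric.isOpen_ball.mem_nhds hzz₀) Metric.ball_subset_closedBall
    · exact isOpen_compl_singleton.mem_nhds fun h ↦ hzx (by rw [h, sub_self])
  set K := Metric.closedBall z ρ with hK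
  have hKU : K ⊆ U := fun y hy ↦ hrU (hρsub hy).1
  have hKc : IsCompact K := isCompact_closedBall z ρ
  set φ : V → ℝ := fun y ↦ ‖y - x‖ ^ 2 with hφ
  -- bounds on `K`
  have hT := isCompact_orthonormalFrames (ι := ι) hKc (hB.continuousOn.mono hKU)
    (fun y hy ↦ hpos y (hKU hy))
  obtain ⟨a, ha, haS⟩ : ∃ a > 0, ∀ y ∈ K, ∀ e : ι → V, IsOrthonormalFrame (B y) e →
      a ≤ ∑ i, fderiv ℝ φ y (e i) ^ 2 := by
    have hcont : Continuous fun z : V × (ι → V) ↦ ∑ i, fderiv ℝ φ z.1 (z.2 i) ^ 2 := by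
      rw [hφ, fderiv_norm_sub_sq]
      simp only [smul_apply, innerSL_apply_apply]
      fun_prop
    obtain ⟨a, ha, h⟩ := hT.exists_forall_le' hcont.continuousOn (a := 0) (by
      rintro ⟨y, e⟩ ⟨hy, he⟩
      refine lt_of_le_of_ne (by positivity) fun h0 ↦ ?_
      have h1 := (Finset.sum_eq_zero_iff_of_nonneg fun i _ ↦ by positivity).1 h0.symm
      have h2 : fderiv ℝ φ y (y - x) = 0 := by
        rw [← he.expansion (y - x), map_sum]
        refine Finset.sum_eq_zero fun i hi ↦ ?_
        rw [map_smul, pow_eq_zero_iff two_ne_zero |>.1 (h1 i hi), smul_zero]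
      rw [hφ, fderiv_norm_sub_sq] at h2
      simp only [smul_apply, innerSL_apply_apply, smul_eq_mul, mul_eq_zero,
        OfNat.ofNat_ne_zero, false_or, inner_self_eq_zero] at h2
      exact (hρsub hy).2 (sub_eq_zero.1 h2))
    exact ⟨a, ha, fun y hy e he ↦ h (y, e) ⟨hy, he⟩⟩
  obtain ⟨A, hA, hAS⟩ : ∃ A > 0, ∀ y ∈ K, ∀ e : ι → V, IsOrthonormalFrame (B y) e →
      laplacianInFrame B y e φ ≤ A := by
    have hdB : ContinuousOn (fun z : V × (ι → V) ↦ fderiv ℝ B z.1)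
        {z | z.1 ∈ K ∧ IsOrthonormalFrame (B z.1) z.2} :=
      (hB.continuousOn_fderiv_of_isOpen hU le_rfl).comp continuousOn_fst fun z hz ↦ hKU hz.1
    have hcont : ContinuousOn (fun z : V × (ι → V) ↦ laplacianInFrame B z.1 z.2 φ)
        {z | z.1 ∈ K ∧ IsOrthonormalFrame (B z.1) z.2} := by
      simp only [laplacianInFrame, hφ, fderiv_fderiv_norm_sub_sq]
      simp only [christoffelLower, fderiv_norm_sub_sq, smul_apply, add_apply, sub_apply,
        ContinuousLinearMap.flip_apply, innerSL_apply_apply]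
      have he : ∀ i, ContinuousOn (fun z : V × (ι → V) ↦ z.2 i)
          {z | z.1 ∈ K ∧ IsOrthonormalFrame (B z.1) z.2} := fun i ↦ by fun_prop
      have h3 : ∀ i j l, ContinuousOn (fun z : V × (ι → V) ↦
          fderiv ℝ B z.1 (z.2 i) (z.2 j) (z.2 l))
          {z | z.1 ∈ K ∧ IsOrthonormalFrame (B z.1) z.2} := fun i j l ↦
        ((hdB.clm_apply (he i)).clm_apply (he j)).clm_apply (he l)
      refine continuousOn_finsetSum _ fun i _ ↦ ContinuousOn.sub (by fun_prop) ?_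
      refine continuousOn_finsetSum _ fun j _ ↦ ContinuousOn.mul ?_ (by fun_prop)
      exact (((h3 i i j).add (h3 i i j)).sub (h3 j i i)).const_smul (1 / 2 : ℝ)
    obtain ⟨A, hA⟩ := hT.bddAbove_image hcont
    exact ⟨max A 1, by positivity,
      fun y hy e he ↦ (hA ⟨(y, e), ⟨hy, he⟩, rfl⟩).trans (le_max_left _ _)⟩
  obtain ⟨C, hC, hcC⟩ : ∃ C > 0, ∀ y ∈ K, c y ≤ C := by
    obtain ⟨C, hC⟩ := hKc.bddAbove_image (hc.mono hKU)
    exact ⟨max C 1, by positivity, fun y hy ↦ (hC ⟨y, hy, rfl⟩).trans (le_max_left _ _)⟩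
  -- The part of the small sphere inside the touching ball is compact and misses the minimum set, so
  -- u exceeds its minimum there by a definite amount.
  obtain ⟨δ, hδ, hδu⟩ : ∃ δ > 0, ∀ y ∈ Metric.sphere z ρ, ‖y - x‖ ≤ ‖z - x‖ → u z₀ + δ ≤ u y := by
    have hcomp : IsCompact (Metric.sphere z ρ ∩ {y | ‖y - x‖ ≤ ‖z - x‖}) :=
      (isCompact_sphere z ρ).inter_right (isClosed_le (by fun_prop) continuous_const)
    obtain ⟨b, hb, h⟩ := hcomp.exists_forall_le' (f := u) (a := u z₀)
      (hu.continuousOn.mono fun y hy ↦ hKU (Metric.sphere_subset_closedBall hy.1)) (by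
        rintro y ⟨hy, hyx⟩
        have hyK : y ∈ K := Metric.sphere_subset_closedBall hy
        refine lt_of_le_of_ne (hmin y (hKU hyK)) fun h0 ↦ ?_
        have := htouch y ⟨(hρsub hyK).1, h0.symm⟩ hyx
        rw [this, Metric.mem_sphere, dist_self] at hy
        exact hρ.ne hy)
    exact ⟨b - u z₀, by linarith, fun y hy hyx ↦ by linarith [h y ⟨hy, hyx⟩]⟩
  obtain ⟨α, hα, hαa⟩ : ∃ α > 0, 2 * A < α * a :=
    ⟨(2 * A + 1) / a, by positivity, by field_simp; linarith⟩
  set v : V → ℝ := fun y ↦ Real.exp (-α * φ y) with hv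
  -- The bound δ/2 preserves the boundary gap after subtracting εv. The bound 1/(2C) lets half of
  -- the good term αS absorb the quadratic gradient term.
  set ε : ℝ := min (δ / 2) (1 / (2 * C)) with hε
  have hε0 : 0 < ε := by positivity
  have hεC : ε * C ≤ 1 / 2 := by
    calc ε * C ≤ 1 / (2 * C) * C := by gcongr; exact min_le_right _ _
      _ = 1 / 2 := by field_simp
  have hφs : ∀ y, ContDiffAt ℝ 2 φ y := fun y ↦ (contDiff_norm_sub_sq x).contDiffAt
  have hvs : ∀ y, ContDiffAt ℝ 2 v y := fun y ↦ (contDiffAt_const.mul (hφs y)).exp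
  have hus : ∀ y ∈ U, ContDiffAt ℝ 2 u y := fun y hy ↦ hu.contDiffAt (hU.mem_nhds hy)
  set h : V → ℝ := fun y ↦ u y - ε * v y with hh
  have hv1 : ∀ y, v y ≤ 1 := fun y ↦ Real.exp_le_one_iff.2 (by
    have : 0 ≤ φ y := by positivity
    nlinarith)
  have hv0 : ∀ y, 0 < v y := fun y ↦ Real.exp_pos _
  -- Inside the touching ball the gap δ wins; outside it v is smaller than at z. So h is smaller at
  -- the centre than on the sphere, and its minimum q over K is interior.
  have hbdry : ∀ y ∈ Metric.sphere z ρ, h z < h y := by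
    intro y hy
    have huz : u z = u z₀ := hzZ.2
    simp only [hh, huz]
    rcases le_or_gt ‖y - x‖ ‖z - x‖ with hle | hlt
    · have := hδu y hy hle
      have : ε ≤ δ / 2 := min_le_left _ _
      nlinarith [hv1 y, hv0 z]
    · have h1 := hmin y (hKU (Metric.sphere_subset_closedBall hy))
      have h2 : v y < v z := Real.exp_lt_exp.2 (by
        have : φ z < φ y := by simp only [hφ]; gcongr
        nlinarith)
      nlinarith
  obtain ⟨q, hqK, hqmin⟩ := hKc.exists_isMinOn ⟨z, Metric.mem_closedBall_self hρ.le⟩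
    (f := h) (fun y hy ↦ ((hus y (hKU hy)).continuousAt.sub
      ((hvs y).continuousAt.const_mul ε)).continuousWithinAt)
  have hqball : q ∈ Metric.ball z ρ := by
    rw [Metric.mem_ball]
    refine lt_of_le_of_ne hqK fun heq ↦ ?_
    exact absurd (hqmin (Metric.mem_closedBall_self hρ.le)) (not_le.2 (hbdry q heq))
  have hqloc : IsLocalMin h q := hqmin.isLocalMin
    (Filter.mem_of_superset (Metric.isOpen_ball.mem_nhds hqball) Metric.ball_subset_closedBall)
  have huq := hus q (hKU hqK)
  have hhq : ContDiffAt ℝ 2 h q := huq.sub (contDiffAt_const.mul (hvs q))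
  obtain ⟨e, he, hle⟩ := hlap q (hKU hqK)
  -- first and second derivatives at the minimum
  have hdh : ∀ y ∈ U, fderiv ℝ h y = fderiv ℝ u y - ε • fderiv ℝ v y := fun y hy ↦
    (((hus y hy).differentiableAt (by norm_num)).hasFDerivAt.sub
      (((hvs y).differentiableAt (by norm_num)).hasFDerivAt.const_mul ε)).fderiv
  have hd1 : ∀ w, fderiv ℝ u q w = ε * fderiv ℝ v q w := fun w ↦ by
    have := hdh q (hKU hqK)
    rw [hqloc.fderiv_eq_zero] at this
    have := congrArg (fun L : V →L[ℝ] ℝ ↦ L w) this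
    simp at this
    linarith
  have hd2 : ∀ w, ε * fderiv ℝ (fderiv ℝ v) q w w ≤ fderiv ℝ (fderiv ℝ u) q w w := fun w ↦ by
    have hnn := hqloc.fderiv_fderiv_nonneg hhq w
    have hev : fderiv ℝ h =ᶠ[𝓝 q] fun y ↦ fderiv ℝ u y - ε • fderiv ℝ v y :=
      Filter.mem_of_superset (hU.mem_nhds (hKU hqK)) hdh
    have h2 : HasFDerivAt (fun y ↦ fderiv ℝ u y - ε • fderiv ℝ v y)
        (fderiv ℝ (fderiv ℝ u) q - ε • fderiv ℝ (fderiv ℝ v) q) q :=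
      ((huq.fderiv_right (m := 1) (by norm_num)).differentiableAt (by norm_num)).hasFDerivAt.sub
        ((((hvs q).fderiv_right (m := 1) (by norm_num)).differentiableAt
          (by norm_num)).hasFDerivAt.const_smul ε)
    rw [hev.fderiv_eq, h2.fderiv] at hnn
    simpa using hnn
  -- Since du = ε dv at q, the Christoffel terms agree and only the second derivatives need
  -- comparing.
  have hlapv : ε * laplacianInFrame B q e v ≤ laplacianInFrame B q e u := by
    simp only [laplacianInFrame, Finset.mul_sum, mul_sub]
    refine Finset.sum_le_sum fun i _ ↦ sub_le_sub (hd2 _) (le_of_eq ?_)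
    refine Finset.sum_congr rfl fun j _ ↦ ?_
    rw [hd1]
    ring
  rw [laplacianInFrame_exp (hφs q) (-α)] at hlapv
  have hdv : ∀ w, fderiv ℝ v q w = v q * (-α * fderiv ℝ φ q w) := fun w ↦ by
    have := ((((hφs q).differentiableAt (by norm_num)).hasFDerivAt).const_mul (-α)).exp.fderiv
    have := congrArg (fun L : V →L[ℝ] ℝ ↦ L w) this
    simpa [hv] using this
  have hsum : ∑ i, fderiv ℝ u q (e i) ^ 2 =
      (ε * v q * α) ^ 2 * ∑ i, fderiv ℝ φ q (e i) ^ 2 := by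
    rw [Finset.mul_sum]
    refine Finset.sum_congr rfl fun i _ ↦ ?_
    rw [hd1, hdv]
    ring
  set S := ∑ i, fderiv ℝ φ q (e i) ^ 2 with hS
  have hSa : a ≤ S := haS q hqK e he
  have hLA := hAS q hqK e he
  set L := laplacianInFrame B q e φ
  rw [hsum] at hle
  have h1 : ε * (v q * (α ^ 2 * S - α * L)) ≤ C * ((ε * v q * α) ^ 2 * S) := by
    have h2 : c q * ((ε * v q * α) ^ 2 * S) ≤ C * ((ε * v q * α) ^ 2 * S) :=
      mul_le_mul_of_nonneg_right (hcC q hqK) (by positivity)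
    refine le_trans (le_of_eq ?_) (hlapv.trans (hle.trans h2))
    ring
  have hevα : 0 < ε * v q * α := by have := hv0 q; positivity
  have h3 : α * S - L ≤ C * (ε * v q * α) * S := by
    refine le_of_mul_le_mul_left (?_ : ε * v q * α * _ ≤ ε * v q * α * _) hevα
    refine le_trans (le_of_eq ?_) (h1.trans (le_of_eq ?_)) <;> ring
  have h4 : C * (ε * v q * α) * S ≤ 1 / 2 * α * S := by
    have : C * (ε * v q * α) ≤ 1 / 2 * α := by
      calc C * (ε * v q * α) = (ε * C) * v q * α := by ring
        _ ≤ 1 / 2 * 1 * α := by gcongr; exact hv1 q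
        _ = 1 / 2 * α := by ring
    exact mul_le_mul_of_nonneg_right this (ha.le.trans hSa)
  -- The bounds give αS/2 ≤ L ≤ A, whereas αS ≥ αa > 2A.
  nlinarith

end MaximumPrinciple

/-! ### Christoffel symbols and Laplacian under pull-back -/

section Pullback

variable {E : Type*} [NormedAddCommGroup E] [NormedSpace ℝ E]
  {E' : Type*} [NormedAddCommGroup E'] [NormedSpace ℝ E']

set_option maxSynthPendingDepth 5 in
theorem christoffelLower_apply (B : E → E →L[ℝ] E →L[ℝ] ℝ) (y u v w : E) :
    christoffelLower B y u v w =
      (1 / 2 : ℝ) * (fderiv ℝ B y u v w + fderiv ℝ B y v u w - fderiv ℝ B y w u v) := by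
  simp [christoffelLower]

theorem hasFDerivAt_fderiv {χ : E → E'} {z : E} (hχ : ContDiffAt ℝ 2 χ z) :
    HasFDerivAt (fderiv ℝ χ) (fderiv ℝ (fderiv ℝ χ) z) z :=
  ((hχ.fderiv_right (m := 1) (by norm_num)).differentiableAt (by norm_num)).hasFDerivAt

set_option maxSynthPendingDepth 5 in
theorem fderiv_bilin_apply {B : E → E' →L[ℝ] E' →L[ℝ] ℝ} {y : E} (hB : DifferentiableAt ℝ B y)
    (u : E) (v w : E') : fderiv ℝ B y u v w = fderiv ℝ (fun z ↦ B z v w) y u := by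
  have h := ((hB.hasFDerivAt.clm_apply (hasFDerivAt_const v y)).clm_apply (hasFDerivAt_const w y))
  rw [h.fderiv]
  simp

set_option maxSynthPendingDepth 5 in
theorem fderiv_pullback_apply {χ : E → E'} {z : E} (hχ : ContDiffAt ℝ 2 χ z)
    {g : E → E →L[ℝ] E →L[ℝ] ℝ} {G : E' → E' →L[ℝ] E' →L[ℝ] ℝ}
    (hg : DifferentiableAt ℝ g z) (hG : DifferentiableAt ℝ G (χ z))
    (h : ∀ᶠ y in 𝓝 z, ∀ v w, g y v w = G (χ y) (fderiv ℝ χ y v) (fderiv ℝ χ y w)) (u v w : E) :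
    fderiv ℝ g z u v w = fderiv ℝ G (χ z) (fderiv ℝ χ z u) (fderiv ℝ χ z v) (fderiv ℝ χ z w) +
      G (χ z) (fderiv ℝ (fderiv ℝ χ) z u v) (fderiv ℝ χ z w) +
      G (χ z) (fderiv ℝ χ z v) (fderiv ℝ (fderiv ℝ χ) z u w) := by
  have hev : (fun y ↦ g y v w) =ᶠ[𝓝 z]
      fun y ↦ G (χ y) (fderiv ℝ χ y v) (fderiv ℝ χ y w) := h.mono fun y hy ↦ hy v w
  have hχ1 : HasFDerivAt χ (fderiv ℝ χ z) z := (hχ.differentiableAt (by norm_num)).hasFDerivAt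
  have hχ2 := hasFDerivAt_fderiv hχ
  have hD := ((hG.hasFDerivAt.comp z hχ1).clm_apply
    (hχ2.clm_apply (hasFDerivAt_const v z))).clm_apply (hχ2.clm_apply (hasFDerivAt_const w z))
  rw [fderiv_bilin_apply hg, hev.fderiv_eq]
  erw [hD.fderiv]
  simp
  ring

/-- In the Koszul combination the six terms containing D²χ cancel in pairs, by symmetry of D²χ and
of G, except two equal ones that absorb the factor 1/2. Here χ need not be a diffeomorphism, so an
immersion is allowed. -/
theorem christoffelLower_pullback {χ : E → E'} {z : E} (hχ : ContDiffAt ℝ 2 χ z)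
    {g : E → E →L[ℝ] E →L[ℝ] ℝ} {G : E' → E' →L[ℝ] E' →L[ℝ] ℝ}
    (hg : DifferentiableAt ℝ g z) (hG : DifferentiableAt ℝ G (χ z))
    (hsymm : ∀ a b, G (χ z) a b = G (χ z) b a)
    (h : ∀ᶠ y in 𝓝 z, ∀ v w, g y v w = G (χ y) (fderiv ℝ χ y v) (fderiv ℝ χ y w)) (u v w : E) :
    christoffelLower g z u v w =
      G (χ z) (fderiv ℝ (fderiv ℝ χ) z u v) (fderiv ℝ χ z w) +
      christoffelLower G (χ z) (fderiv ℝ χ z u) (fderiv ℝ χ z v) (fderiv ℝ χ z w) := by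
  have hs : ∀ a b, fderiv ℝ (fderiv ℝ χ) z a b = fderiv ℝ (fderiv ℝ χ) z b a :=
    fun a b ↦ hχ.isSymmSndFDerivAt (by simp) a b
  simp only [christoffelLower_apply, fderiv_pullback_apply hχ hg hG h]
  rw [hs v u, hs w u, hs w v, hsymm (fderiv ℝ (fderiv ℝ χ) z u w),
    hsymm (fderiv ℝ χ z u) (fderiv ℝ (fderiv ℝ χ) z v w)]
  ring

/-- The Laplacian does not depend on the coordinates. -/
theorem laplacianInFrame_pullback {ι : Type*} [Fintype ι] [DecidableEq ι]
    {χ : E → E'} {z : E} (hχ : ContDiffAt ℝ 2 χ z)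
    {g : E → E →L[ℝ] E →L[ℝ] ℝ} {G : E' → E' →L[ℝ] E' →L[ℝ] ℝ}
    (hg : DifferentiableAt ℝ g z) (hG : DifferentiableAt ℝ G (χ z))
    (hsymm : ∀ a b, G (χ z) a b = G (χ z) b a)
    (h : ∀ᶠ y in 𝓝 z, ∀ v w, g y v w = G (χ y) (fderiv ℝ χ y v) (fderiv ℝ χ y w))
    {e : ι → E} {e' : ι → E'} (he : ∀ i, fderiv ℝ χ z (e i) = e' i)
    (he' : IsOrthonormalFrame (G (χ z)) e') {φ : E' → ℝ} (hφ : ContDiffAt ℝ 2 φ (χ z)) :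
    laplacianInFrame g z e (φ ∘ χ) = laplacianInFrame G (χ z) e' φ := by
  have hχ1 : ∀ᶠ y in 𝓝 z, DifferentiableAt ℝ χ y :=
    (hχ.eventually (by simp)).mono fun y hy ↦ hy.differentiableAt (by norm_num)
  have hφ1 : ∀ᶠ y in 𝓝 z, DifferentiableAt ℝ φ (χ y) :=
    hχ.continuousAt.eventually
      ((hφ.eventually (by simp)).mono fun y hy ↦ hy.differentiableAt (by norm_num))
  have hd : fderiv ℝ (φ ∘ χ) =ᶠ[𝓝 z] fun y ↦ (fderiv ℝ φ (χ y)).comp (fderiv ℝ χ y) := by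
    filter_upwards [hχ1, hφ1] with y h1 h2 using fderiv_comp y h2 h1
  have hd2 : ∀ a b, fderiv ℝ (fderiv ℝ (φ ∘ χ)) z a b =
      fderiv ℝ (fderiv ℝ φ) (χ z) (fderiv ℝ χ z a) (fderiv ℝ χ z b) +
        fderiv ℝ φ (χ z) (fderiv ℝ (fderiv ℝ χ) z a b) := by
    intro a b
    rw [hd.fderiv_eq]
    have := ((hasFDerivAt_fderiv hφ).comp z hχ1.self_of_nhds.hasFDerivAt).clm_comp
      (hasFDerivAt_fderiv hχ)
    erw [this.fderiv]
    simp [add_comm]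
  simp only [laplacianInFrame, hd2, hd.self_of_nhds, christoffelLower_pullback hχ hg hG hsymm h,
    ContinuousLinearMap.comp_apply, he, add_mul, Finset.sum_add_distrib]
  refine Finset.sum_congr rfl fun i _ ↦ ?_
  -- Expanding D²χ(e i, e i) in the frame e' shows that the extra Christoffel term cancels the extra
  -- term of the second derivative of φ ∘ χ.
  have : ∑ j, G (χ z) (fderiv ℝ (fderiv ℝ χ) z (e i) (e i)) (e' j) * fderiv ℝ φ (χ z) (e' j) =
      fderiv ℝ φ (χ z) (fderiv ℝ (fderiv ℝ χ) z (e i) (e i)) := by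
    conv_rhs => rw [← he'.expansion (fderiv ℝ (fderiv ℝ χ) z (e i) (e i)), map_sum]
    simp
  rw [this]
  ring

end Pullback

/-! ### Metrics in charts -/

section ChartMetric

variable {E : Type*} [NormedAddCommGroup E] [NormedSpace ℝ E]
  {H : Type*} [TopologicalSpace H] {J : ModelWithCorners ℝ E H}
  {N : Type*} [TopologicalSpace N] [ChartedSpace H N]
  {E' : Type*} [NormedAddCommGroup E'] [NormedSpace ℝ E']
  {H' : Type*} [TopologicalSpace H'] {J' : ModelWithCorners ℝ E' H'}
  {N' : Type*} [TopologicalSpace N'] [ChartedSpace H' N']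

theorem chartMetric_apply (G : ∀ x : N, TangentSpace J x →L[ℝ] TangentSpace J x →L[ℝ] ℝ) (q : N)
    (y v w : E) : chartMetric J G q y v w =
      G ((extChartAt J q).symm y) (mfderiv 𝓘(ℝ, E) J (extChartAt J q).symm y v)
        (mfderiv 𝓘(ℝ, E) J (extChartAt J q).symm y w) := rfl

/-- Tangent spaces at different points are all definitionally E, so vectors over propositionally
equal base points can be compared in E without transport. -/
theorem metricTensor_congr (G : ∀ x : N, TangentSpace J x →L[ℝ] TangentSpace J x →L[ℝ] ℝ)
    {x x' : N} (hx : x = x') {a b : TangentSpace J x} {a' b' : TangentSpace J x'}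
    (ha : @Eq E a a') (hb : @Eq E b b') : G x a b = G x' a' b' := by
  subst hx
  have ha' : a = a' := ha
  have hb' : b = b' := hb
  rw [ha', hb']

theorem mdifferentiableAt_extChartAt_symm [J.Boundaryless] [IsManifold J 1 N] {q : N} {y : E}
    (hy : y ∈ (extChartAt J q).target) : MDifferentiableAt 𝓘(ℝ, E) J (extChartAt J q).symm y :=
  ((contMDiffOn_extChartAt_symm (n := 1) q).contMDiffAt
    ((isOpen_extChartAt_target q).mem_nhds hy)).mdifferentiableAt one_ne_zero

/-- The differential of the inverse of the preferred chart at the centre is the identity. -/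
theorem mfderiv_extChartAt_symm_self [J.Boundaryless] [IsManifold J 1 N] (q : N) (v : E) :
    @Eq E (mfderiv 𝓘(ℝ, E) J (extChartAt J q).symm (extChartAt J q q) v) v := by
  have hm := mdifferentiableAt_extChartAt_symm (J := J) (mem_extChartAt_target q)
  rw [hm.mfderiv]
  have hev : writtenInExtChartAt 𝓘(ℝ, E) J (extChartAt J q q) (extChartAt J q).symm
      =ᶠ[𝓝 (extChartAt J q q)] id := by
    filter_upwards [(isOpen_extChartAt_target q).mem_nhds (mem_extChartAt_target (I := J) q)]
      with y hy
    simp only [writtenInExtChartAt, extChartAt_to_inv, Function.comp_apply,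
      extChartAt_model_space_eq_id, PartialEquiv.refl_symm, PartialEquiv.refl_coe, id]
    exact (extChartAt J q).right_inv hy
  have : fderivWithin ℝ (writtenInExtChartAt 𝓘(ℝ, E) J (extChartAt J q q) (extChartAt J q).symm)
      (Set.range 𝓘(ℝ, E)) (extChartAt J q q) = ContinuousLinearMap.id ℝ E := by
    rw [ModelWithCorners.range_eq_univ, fderivWithin_univ, hev.fderiv_eq, fderiv_id]
  exact congrArg (fun L : E →L[ℝ] E ↦ L v) this

theorem chartMetric_self [J.Boundaryless] [IsManifold J 1 N]
    (G : ∀ x : N, TangentSpace J x →L[ℝ] TangentSpace J x →L[ℝ] ℝ) (q : N)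
    (v w : E) : chartMetric J G q (extChartAt J q q) v w =
      G q (v : TangentSpace J q) (w : TangentSpace J q) :=
  metricTensor_congr G (extChartAt_to_inv q) (mfderiv_extChartAt_symm_self q v)
    (mfderiv_extChartAt_symm_self q w)

/-- If `Φ` is isometric, so is its expression in charts. -/
theorem chartMetric_pullback [J.Boundaryless] [IsManifold J 1 N] [J'.Boundaryless]
    [IsManifold J' 1 N'] {G : ∀ x : N, TangentSpace J x →L[ℝ] TangentSpace J x →L[ℝ] ℝ}
    {G' : ∀ x : N', TangentSpace J' x →L[ℝ] TangentSpace J' x →L[ℝ] ℝ} {Φ : N → N'}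
    {p : N} {q : N'} {y : E} (hy : y ∈ (extChartAt J p).target)
    (hq : Φ ((extChartAt J p).symm y) ∈ (extChartAt J' q).source)
    (hΦ : MDifferentiableAt J J' Φ ((extChartAt J p).symm y))
    (hG : ∀ v w, G ((extChartAt J p).symm y) v w = G' (Φ ((extChartAt J p).symm y))
      (mfderiv J J' Φ _ v) (mfderiv J J' Φ _ w)) (v w : E) :
    chartMetric J G p y v w =
      chartMetric J' G' q ((extChartAt J' q ∘ Φ ∘ (extChartAt J p).symm) y)
        (fderiv ℝ (extChartAt J' q ∘ Φ ∘ (extChartAt J p).symm) y v)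
        (fderiv ℝ (extChartAt J' q ∘ Φ ∘ (extChartAt J p).symm) y w) := by
  set χ := extChartAt J' q ∘ Φ ∘ (extChartAt J p).symm with hχ
  have hs := mdifferentiableAt_extChartAt_symm (J := J) hy
  have hχy : χ y ∈ (extChartAt J' q).target := (extChartAt J' q).map_source hq
  have hs' := mdifferentiableAt_extChartAt_symm (J := J') hχy
  have hΦs : MDifferentiableAt 𝓘(ℝ, E) J' (Φ ∘ (extChartAt J p).symm) y := hΦ.comp y hs
  have hχd : MDifferentiableAt 𝓘(ℝ, E) 𝓘(ℝ, E') χ y :=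
    (mdifferentiableAt_extChartAt (by simpa using hq)).comp y hΦs
  -- Differentiating both sides of this local identity by the chain rule matches the two
  -- push-forwards of a vector.
  have hev : (extChartAt J' q).symm ∘ χ =ᶠ[𝓝 y] Φ ∘ (extChartAt J p).symm := by
    filter_upwards [hΦs.continuousAt.preimage_mem_nhds
      ((isOpen_extChartAt_source q).mem_nhds hq)] with z hz
    exact (extChartAt J' q).left_inv hz
  have hvec : ∀ v : E, @Eq E' (mfderiv J J' Φ _ (mfderiv 𝓘(ℝ, E) J (extChartAt J p).symm y v))
      (mfderiv 𝓘(ℝ, E') J' (extChartAt J' q).symm (χ y) (fderiv ℝ χ y v)) := by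
    intro v
    have h1 : mfderiv 𝓘(ℝ, E) J' (Φ ∘ (extChartAt J p).symm) y = _ := mfderiv_comp y hΦ hs
    have h2 : mfderiv 𝓘(ℝ, E) J' ((extChartAt J' q).symm ∘ χ) y = _ := mfderiv_comp y hs' hχd
    have h3 := hev.mfderiv_eq (I := 𝓘(ℝ, E)) (I' := J')
    rw [mfderiv_eq_fderiv] at h2
    have h4 := congrArg (fun L : E →L[ℝ] E' ↦ L v) h1
    have h5 := congrArg (fun L : E →L[ℝ] E' ↦ L v) h2
    have h6 := congrArg (fun L : E →L[ℝ] E' ↦ L v) h3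
    exact h4.symm.trans (h6.symm.trans h5)
  rw [chartMetric_apply, chartMetric_apply, hG]
  exact metricTensor_congr G' (hev.self_of_nhds.symm) (hvec v) (hvec w)

end ChartMetric

/-! ### Smoothness and positivity of a Riemannian metric in charts -/

section Riemannian

variable {E : Type*} [NormedAddCommGroup E] [NormedSpace ℝ E]
  {H : Type*} [TopologicalSpace H] (J : ModelWithCorners ℝ E H)
  {N : Type*} [TopologicalSpace N] [ChartedSpace H N]
  [RiemannianBundle (fun x : N ↦ TangentSpace J x)]

/-- The Riemannian metric of `N` as a family of bilinear forms. -/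
def riemannianForm (x : N) : TangentSpace J x →L[ℝ] TangentSpace J x →L[ℝ] ℝ := innerSL ℝ

variable {J}

theorem riemannianForm_apply {x : N} (v w : TangentSpace J x) :
    riemannianForm J x v w = inner ℝ v w := rfl

theorem chartMetric_riemannianForm_symm (p : N) (y v w : E) :
    chartMetric J (riemannianForm J) p y v w = chartMetric J (riemannianForm J) p y w v := by
  rw [chartMetric_apply, chartMetric_apply]
  exact real_inner_comm (F := TangentSpace J ((extChartAt J p).symm y)) _ _

/-- The tangent map of the inverse chart sends constant fields to smooth sections of the tangent
bundle, and a smooth metric pairs smooth sections smoothly. -/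
theorem contDiffOn_chartMetric_riemannianForm [FiniteDimensional ℝ E] [J.Boundaryless]
    [IsManifold J ∞ N] [IsContMDiffRiemannianBundle J ∞ E (fun x : N ↦ TangentSpace J x)] (p : N) :
    ContDiffOn ℝ ∞ (chartMetric J (riemannianForm J) p) (extChartAt J p).target := by
  refine contDiffOn_clm_apply.2 fun v ↦ contDiffOn_clm_apply.2 fun w ↦ ?_
  have hsec : ∀ v : E, ContMDiffOn 𝓘(ℝ, E) (J.prod 𝓘(ℝ, E)) ∞
      (fun y ↦ (⟨(extChartAt J p).symm y, mfderiv 𝓘(ℝ, E) J (extChartAt J p).symm y v⟩ :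
        TotalSpace E (fun x : N ↦ TangentSpace J x))) (extChartAt J p).target := by
    intro v
    have ho := isOpen_extChartAt_target (I := J) p
    have h1 : ContMDiffOn 𝓘(ℝ, E) J ∞ (extChartAt J p).symm (extChartAt J p).target :=
      contMDiffOn_extChartAt_symm p
    have h2 := h1.contMDiffOn_tangentMapWithin (m := ∞) (by simp) ho.uniqueMDiffOn
    have h3 : ContMDiff 𝓘(ℝ, E) (𝓘(ℝ, E)).tangent ∞
        (fun y : E ↦ (⟨y, v⟩ : TangentBundle 𝓘(ℝ, E) E)) := by
      intro y
      exact contMDiffAt_vectorSpace_iff_contDiffAt.2 contDiffAt_const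
    refine (h2.comp h3.contMDiffOn (fun y hy ↦ hy)).congr fun y hy ↦ ?_
    simp only [Function.comp_apply, tangentMapWithin]
    rw [mfderivWithin_of_isOpen ho hy]
  have := ContMDiffOn.inner_bundle (E := fun x : N ↦ TangentSpace J x) (hsec v) (hsec w)
  exact this.contDiffOn

/-- The differential of the inverse chart is injective, since the differential of the chart is a
left inverse. -/
theorem chartMetric_riemannianForm_pos [J.Boundaryless] [IsManifold J 1 N] {p : N} {y : E}
    (hy : y ∈ (extChartAt J p).target) {v : E} (hv : v ≠ 0) :
    0 < chartMetric J (riemannianForm J) p y v v := by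
  rw [chartMetric_apply, riemannianForm_apply]
  refine real_inner_self_pos.2 fun h0 ↦ hv ?_
  have hc := congrArg (fun L : E →L[ℝ] E ↦ L v)
    (mfderiv_extChartAt_comp_mfderivWithin_extChartAt_symm (I := J) hy)
  rw [ModelWithCorners.range_eq_univ, mfderivWithin_univ] at hc
  exact hc.symm.trans ((congrArg (mfderiv J 𝓘(ℝ, E) (extChartAt J p) _) h0).trans (map_zero _))

end Riemannian

/-! ### The spacetime metric in charts -/

section SpacetimeChart

variable {m : ℕ} {F : Type*} [TopologicalSpace F] [ChartedSpace (EuclideanSpace ℝ (Fin m)) F]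

theorem extChartAt_stModel (q : ℝ × F) : extChartAt (stModel m) q =
    (PartialEquiv.refl ℝ).prod (extChartAt (𝓡 m) q.2) := by
  rw [extChartAt_prod, extChartAt_model_space_eq_id]

theorem extChartAt_stModel_symm (q : ℝ × F) (y : ℝ × EuclideanSpace ℝ (Fin m)) :
    (extChartAt (stModel m) q).symm y = (y.1, (extChartAt (𝓡 m) q.2).symm y.2) := by
  rw [extChartAt_stModel]
  rfl

theorem extChartAt_stModel_apply (q x : ℝ × F) :
    extChartAt (stModel m) q x = (x.1, extChartAt (𝓡 m) q.2 x.2) := by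
  rw [extChartAt_stModel]
  rfl

theorem mem_extChartAt_stModel_target {q : ℝ × F} {y : ℝ × EuclideanSpace ℝ (Fin m)} :
    y ∈ (extChartAt (stModel m) q).target ↔ y.2 ∈ (extChartAt (𝓡 m) q.2).target := by
  rw [extChartAt_stModel]
  exact ⟨fun h ↦ h.2, fun h ↦ ⟨trivial, h⟩⟩

variable [RiemannianBundle (fun x : F ↦ TangentSpace (𝓡 m) x)]

theorem metric_apply (f : ℝ → ℝ) (q : ℝ × F) (v w : TangentSpace (stModel m) q) :
    metric f q v w = -(v.1 * w.1) + f q.1 ^ 2 *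
      riemannianForm (𝓡 m) q.2 (v.2 : TangentSpace (𝓡 m) q.2) (w.2 : TangentSpace (𝓡 m) q.2) := by
  have h1 : mfderiv (stModel m) 𝓘(ℝ, ℝ) (Prod.fst : ℝ × F → ℝ) q = _ := mfderiv_fst
  have h2 : mfderiv (stModel m) (𝓡 m) (Prod.snd : ℝ × F → F) q = _ := mfderiv_snd
  simp only [metric, h1, h2]
  rfl

variable [IsManifold (𝓡 m) ∞ F]

theorem chartMetric_metric (f : ℝ → ℝ) (q : ℝ × F) {y : ℝ × EuclideanSpace ℝ (Fin m)}
    (hy : y.2 ∈ (extChartAt (𝓡 m) q.2).target) (v w : ℝ × EuclideanSpace ℝ (Fin m)) :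
    chartMetric (stModel m) (metric f) q y v w = -(v.1 * w.1) +
      f y.1 ^ 2 * chartMetric (𝓡 m) (riemannianForm (𝓡 m)) q.2 y.2 v.2 w.2 := by
  have : IsManifold (𝓡 m) 1 F := IsManifold.of_le (n := ∞) (by simp)
  have hd := mdifferentiableAt_extChartAt_symm (J := stModel m) (mem_extChartAt_stModel_target.2 hy)
  have hF := mdifferentiableAt_extChartAt_symm (J := 𝓡 m) hy
  have h1 : ∀ v : ℝ × EuclideanSpace ℝ (Fin m),
      @Eq ℝ (Prod.fst (α := ℝ) (β := EuclideanSpace ℝ (Fin m))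
        (mfderiv 𝓘(ℝ, ℝ × EuclideanSpace ℝ (Fin m)) (stModel m) (extChartAt (stModel m) q).symm y v)) v.1 := by
    intro v
    have ha := mfderiv_comp (g := (Prod.fst : ℝ × F → ℝ)) (I' := stModel m) (I'' := 𝓘(ℝ, ℝ)) y
      mdifferentiableAt_fst hd
    have hb : (Prod.fst : ℝ × F → ℝ) ∘ (extChartAt (stModel m) q).symm = Prod.fst :=
      funext fun z ↦ by simp only [Function.comp_apply, extChartAt_stModel_symm]
    rw [hb, mfderiv_eq_fderiv, fderiv_fst, mfderiv_fst] at ha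
    exact (congrArg (fun L : ℝ × EuclideanSpace ℝ (Fin m) →L[ℝ] ℝ ↦ L v) ha).symm
  have h2 : ∀ v : ℝ × EuclideanSpace ℝ (Fin m),
      @Eq (EuclideanSpace ℝ (Fin m)) (Prod.snd (α := ℝ) (β := EuclideanSpace ℝ (Fin m))
        (mfderiv 𝓘(ℝ, ℝ × EuclideanSpace ℝ (Fin m)) (stModel m) (extChartAt (stModel m) q).symm y v))
        (mfderiv 𝓘(ℝ, EuclideanSpace ℝ (Fin m)) (𝓡 m) (extChartAt (𝓡 m) q.2).symm y.2 v.2) := by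
    intro v
    have ha := mfderiv_comp (g := (Prod.snd : ℝ × F → F)) (I' := stModel m) (I'' := 𝓡 m) y
      mdifferentiableAt_snd hd
    have hb : (Prod.snd : ℝ × F → F) ∘ (extChartAt (stModel m) q).symm =
        (extChartAt (𝓡 m) q.2).symm ∘ Prod.snd :=
      funext fun z ↦ by simp only [Function.comp_apply, extChartAt_stModel_symm]
    have hc : mfderiv 𝓘(ℝ, ℝ × EuclideanSpace ℝ (Fin m)) (𝓡 m)
        ((extChartAt (𝓡 m) q.2).symm ∘ Prod.snd) y = _ :=
      mfderiv_comp (I' := 𝓘(ℝ, EuclideanSpace ℝ (Fin m))) y hF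
        differentiableAt_snd.mdifferentiableAt
    rw [hb, mfderiv_snd] at ha
    rw [mfderiv_eq_fderiv, fderiv_snd] at hc
    exact (congrArg (fun L : ℝ × EuclideanSpace ℝ (Fin m) →L[ℝ] EuclideanSpace ℝ (Fin m) ↦ L v)
      (hc.symm.trans ha)).symm
  rw [chartMetric_apply, metric_apply, chartMetric_apply]
  have hpt := extChartAt_stModel_symm (m := m) q y
  congr 1
  · exact congrArg Neg.neg (congrArg₂ (· * ·) (h1 v) (h1 w))
  · refine congrArg₂ (· * ·) ?_ (metricTensor_congr _ (congrArg Prod.snd hpt) (h2 v) (h2 w))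
    rw [hpt]

theorem chartMetric_metric_symm (f : ℝ → ℝ) (q : ℝ × F) {y : ℝ × EuclideanSpace ℝ (Fin m)}
    (hy : y.2 ∈ (extChartAt (𝓡 m) q.2).target) (v w : ℝ × EuclideanSpace ℝ (Fin m)) :
    chartMetric (stModel m) (metric f) q y v w = chartMetric (stModel m) (metric f) q y w v := by
  rw [chartMetric_metric f q hy, chartMetric_metric f q hy, chartMetric_riemannianForm_symm,
    mul_comm v.1]

/-- A nondegenerate bilinear form on a finite-dimensional space can be used to raise indices. -/
theorem apply_inverse_of_nondegenerate {E : Type*} [NormedAddCommGroup E] [NormedSpace ℝ E]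
    [FiniteDimensional ℝ E] {b : E →L[ℝ] E →L[ℝ] ℝ} (hb : ∀ v ≠ 0, ∃ w, b v w ≠ 0)
    (l : E →L[ℝ] ℝ) : b (b.inverse l) = l := by
  have hinj : Function.Injective (b : E →ₗ[ℝ] E →L[ℝ] ℝ) := by
    refine (injective_iff_map_eq_zero _).2 fun v hv ↦ ?_
    by_contra h
    obtain ⟨w, hw⟩ := hb v h
    exact hw (congrArg (fun L : E →L[ℝ] ℝ ↦ L w) hv)
  have hfin : Module.finrank ℝ E = Module.finrank ℝ (E →L[ℝ] ℝ) := by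
    rw [← (LinearMap.toContinuousLinearMap (𝕜 := ℝ) (E := E) (F' := ℝ)).finrank_eq]
    exact (Subspace.dual_finrank_eq (K := ℝ) (V := E)).symm
  let b' : E ≃L[ℝ] (E →L[ℝ] ℝ) :=
    (LinearEquiv.ofInjectiveOfFinrankEq (b : E →ₗ[ℝ] E →L[ℝ] ℝ) hinj hfin).toContinuousLinearEquiv
  have hbb' : b = (b' : E →L[ℝ] E →L[ℝ] ℝ) := by ext; rfl
  rw [hbb', ContinuousLinearMap.inverse_equiv]
  simp

/-- `ContinuousLinearMap.inverse` is 0 on noninvertible maps, so raising the index is meaningful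
only once the Lorentzian form is known to be nondegenerate. -/
theorem chartMetric_metric_christoffel {f : ℝ → ℝ} {q : ℝ × F}
    {y : ℝ × EuclideanSpace ℝ (Fin m)} (hf : 0 < f y.1)
    (hy : y.2 ∈ (extChartAt (𝓡 m) q.2).target) (u v w : ℝ × EuclideanSpace ℝ (Fin m)) :
    chartMetric (stModel m) (metric f) q y
        (christoffel (chartMetric (stModel m) (metric f) q) y u v) w =
      christoffelLower (chartMetric (stModel m) (metric f) q) y u v w := by
  have : IsManifold (𝓡 m) 1 F := IsManifold.of_le (n := ∞) (by simp)
  rw [christoffel, apply_inverse_of_nondegenerate]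
  intro v hv
  -- Pairing v with its time reflection turns the Lorentzian form into a positive definite one.
  refine ⟨(-v.1, v.2), ne_of_gt ?_⟩
  rw [chartMetric_metric f q hy]
  rcases eq_or_ne v.2 0 with h | h
  · have : v.1 ≠ 0 := fun h' ↦ hv (Prod.ext h' h)
    simp only [h, map_zero, mul_zero, add_zero]
    have := mul_self_pos.2 this
    linarith
  · have h1 := chartMetric_riemannianForm_pos hy h
    have h2 : 0 < f y.1 ^ 2 := by positivity
    have := mul_pos h2 h1
    have := mul_self_nonneg v.1
    linarith

variable [IsContMDiffRiemannianBundle (𝓡 m) ∞ (EuclideanSpace ℝ (Fin m))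
  (fun x : F ↦ TangentSpace (𝓡 m) x)]

theorem contDiffOn_chartMetric_metric {f : ℝ → ℝ} {I : Set ℝ} (hf : ContDiffOn ℝ ∞ f I)
    (q : ℝ × F) : ContDiffOn ℝ ∞ (chartMetric (stModel m) (metric f) q)
      (I ×ˢ (extChartAt (𝓡 m) q.2).target) := by
  refine contDiffOn_clm_apply.2 fun v ↦ contDiffOn_clm_apply.2 fun w ↦ ?_
  refine ContDiffOn.congr ?_ fun y hy ↦ chartMetric_metric f q hy.2 v w
  have h1 : ContDiffOn ℝ ∞ (fun y : ℝ × EuclideanSpace ℝ (Fin m) ↦ f y.1)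
      (I ×ˢ (extChartAt (𝓡 m) q.2).target) := hf.comp contDiffOn_fst fun y hy ↦ hy.1
  have h2 : ContDiffOn ℝ ∞ (fun y : ℝ × EuclideanSpace ℝ (Fin m) ↦
      chartMetric (𝓡 m) (riemannianForm (𝓡 m)) q.2 y.2) (I ×ˢ (extChartAt (𝓡 m) q.2).target) :=
    (contDiffOn_chartMetric_riemannianForm q.2).comp contDiffOn_snd fun y hy ↦ hy.2
  exact contDiffOn_const.add ((h1.pow 2).mul
    ((h2.clm_apply contDiffOn_const).clm_apply contDiffOn_const))

theorem differentiableAt_chartMetric_metric {f : ℝ → ℝ} {I : Set ℝ} (hI : IsOpen I)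
    (hf : ContDiffOn ℝ ∞ f I) {q : ℝ × F} {y : ℝ × EuclideanSpace ℝ (Fin m)} (hyI : y.1 ∈ I)
    (hy : y.2 ∈ (extChartAt (𝓡 m) q.2).target) :
    DifferentiableAt ℝ (chartMetric (stModel m) (metric f) q) y :=
  ((contDiffOn_chartMetric_metric hf q).contDiffAt
    ((hI.prod (isOpen_extChartAt_target q.2)).mem_nhds ⟨hyI, hy⟩)).differentiableAt (by simp)

/-- The time component of the Christoffel symbols of the spacetime metric. -/
theorem christoffelLower_chartMetric_metric {f : ℝ → ℝ} {I : Set ℝ} (hI : IsOpen I)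
    (hf : ContDiffOn ℝ ∞ f I) {q : ℝ × F} {y : ℝ × EuclideanSpace ℝ (Fin m)} (hyI : y.1 ∈ I)
    (hy : y.2 ∈ (extChartAt (𝓡 m) q.2).target) (u : ℝ × EuclideanSpace ℝ (Fin m)) :
    christoffelLower (chartMetric (stModel m) (metric f) q) y u u (1, 0) =
      -(deriv f y.1 * f y.1 * chartMetric (𝓡 m) (riemannianForm (𝓡 m)) q.2 y.2 u.2 u.2) := by
  have hd := differentiableAt_chartMetric_metric hI hf hyI hy
  have hnhds : ∀ᶠ z : ℝ × EuclideanSpace ℝ (Fin m) in 𝓝 y,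
      z.2 ∈ (extChartAt (𝓡 m) q.2).target :=
    continuous_snd.continuousAt.preimage_mem_nhds ((isOpen_extChartAt_target q.2).mem_nhds hy)
  rw [christoffelLower_apply, fderiv_bilin_apply hd, fderiv_bilin_apply hd]
  -- Products with ∂_t are constant, so only the time derivative of the metric on (u, u) survives in
  -- the Koszul formula.
  have h1 : (fun z ↦ chartMetric (stModel m) (metric f) q z u (1, 0)) =ᶠ[𝓝 y] fun _ ↦ -u.1 := by
    filter_upwards [hnhds] with z hz
    rw [chartMetric_metric f q hz]
    simp
  have h2 : (fun z ↦ chartMetric (stModel m) (metric f) q z u u) =ᶠ[𝓝 y]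
      fun z ↦ -(u.1 * u.1) +
        f z.1 ^ 2 * chartMetric (𝓡 m) (riemannianForm (𝓡 m)) q.2 z.2 u.2 u.2 := by
    filter_upwards [hnhds] with z hz
    rw [chartMetric_metric f q hz]
  have hf1 : HasDerivAt f (deriv f y.1) y.1 :=
    ((hf.contDiffAt (hI.mem_nhds hyI)).differentiableAt (by simp)).hasDerivAt
  have hf2 : HasFDerivAt (fun z : ℝ × EuclideanSpace ℝ (Fin m) ↦ f z.1)
      (deriv f y.1 • ContinuousLinearMap.fst ℝ ℝ (EuclideanSpace ℝ (Fin m))) y :=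
    hf1.comp_hasFDerivAt y hasFDerivAt_fst
  have hg1 : DifferentiableAt ℝ (fun x ↦ chartMetric (𝓡 m) (riemannianForm (𝓡 m)) q.2 x u.2 u.2)
      y.2 := by
    have : DifferentiableAt ℝ (chartMetric (𝓡 m) (riemannianForm (𝓡 m)) q.2) y.2 :=
      ((contDiffOn_chartMetric_riemannianForm q.2).contDiffAt
        ((isOpen_extChartAt_target q.2).mem_nhds hy)).differentiableAt (by simp)
    exact (this.clm_apply (differentiableAt_const _)).clm_apply (differentiableAt_const _)
  have hg2 : HasFDerivAt (fun z : ℝ × EuclideanSpace ℝ (Fin m) ↦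
      chartMetric (𝓡 m) (riemannianForm (𝓡 m)) q.2 z.2 u.2 u.2) _ y :=
    HasFDerivAt.comp y hg1.hasFDerivAt hasFDerivAt_snd
  have h3 := (((hf2.pow 2).mul hg2).const_add (-(u.1 * u.1))).fderiv
  rw [h1.fderiv_eq, h2.fderiv_eq]
  erw [h3]
  simp
  ring

end SpacetimeChart

/-! ### The Laplacian of the height function -/

section Frame

variable {k : ℕ} {M : Type*} [TopologicalSpace M] [ChartedSpace (EuclideanSpace ℝ (Fin k)) M]

theorem finrank_tangentSpace (p : M) : Module.finrank ℝ (TangentSpace (𝓡 k) p) = k :=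
  finrank_euclideanSpace_fin (𝕜 := ℝ) (n := k)

variable [RiemannianBundle (fun p : M ↦ TangentSpace (𝓡 k) p)]

/-- The orthonormal basis `onb` in the preferred chart, indexed by `Fin k`. -/
def chartFrame (p : M) (i : Fin k) : EuclideanSpace ℝ (Fin k) :=
  onb k p (Fin.cast (finrank_tangentSpace p).symm i)

theorem sum_onb {A : Type*} [AddCommMonoid A] (p : M) (h : EuclideanSpace ℝ (Fin k) → A) :
    ∑ i, h (onb k p i) = ∑ i, h (chartFrame p i) :=
  (Fintype.sum_equiv (finCongr (finrank_tangentSpace p).symm) _ _ fun _ ↦ rfl).symm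

variable [IsManifold (𝓡 k) ∞ M]

theorem isOrthonormalFrame_chartFrame (p : M) :
    IsOrthonormalFrame (chartMetric (𝓡 k) (riemannianForm (𝓡 k)) p (extChartAt (𝓡 k) p p))
      (chartFrame p) := by
  have : IsManifold (𝓡 k) 1 M := IsManifold.of_le (n := ∞) (by simp)
  refine ⟨fun i j ↦ ?_, fun v ↦ ?_⟩
  · rw [chartMetric_self]
    have := (orthonormal_iff_ite.1 (onb k p).orthonormal) (Fin.cast (finrank_tangentSpace p).symm i)
      (Fin.cast (finrank_tangentSpace p).symm j)
    simp only [Fin.cast_inj] at this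
    exact this
  · simp only [chartMetric_self]
    have h1 := (onb k p).sum_repr' (v : TangentSpace (𝓡 k) p)
    rw [← sum_onb p fun w : EuclideanSpace ℝ (Fin k) ↦
      (riemannianForm (𝓡 k) p (v : TangentSpace (𝓡 k) p) (w : TangentSpace (𝓡 k) p)) • w]
    refine Eq.trans ?_ h1
    refine Finset.sum_congr rfl fun i _ ↦ ?_
    exact congrArg (fun c : ℝ ↦ c • (onb k p i : EuclideanSpace ℝ (Fin k)))
      (real_inner_comm (F := TangentSpace (𝓡 k) p) _ _)

end Frame

/-! ### The mean curvature vector against the time field -/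

section MeanCurvature

variable {m k : ℕ} {F : Type*} [TopologicalSpace F] [ChartedSpace (EuclideanSpace ℝ (Fin m)) F]
  [RiemannianBundle (fun x : F ↦ TangentSpace (𝓡 m) x)]
  {M : Type*} [TopologicalSpace M] [ChartedSpace (EuclideanSpace ℝ (Fin k)) M]
  [RiemannianBundle (fun p : M ↦ TangentSpace (𝓡 k) p)]

theorem metric_timeField (f : ℝ → ℝ) (q : ℝ × F) (v : TangentSpace (stModel m) q) :
    metric f q v (timeField q) = -v.1 := by
  rw [metric_apply]
  have : riemannianForm (𝓡 m) q.2 (v.2 : TangentSpace (𝓡 m) q.2)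
    ((timeField (m := m) q).2 : TangentSpace (𝓡 m) q.2) = 0 := map_zero _
  rw [this, mul_zero, add_zero]
  exact congrArg Neg.neg (mul_one _)

/-- The tangential correction enters through ḡ(dψ E_j, ∂_t), which is minus the time component of dψ
E_j. -/
theorem metric_meanCurvature_timeField (f : ℝ → ℝ) (ψ : M → ℝ × F) (p : M) :
    k * metric f (ψ p) (meanCurvature (k := k) (stModel m) (metric f) ψ p) (timeField (ψ p)) =
      ∑ i, (-(metric f (ψ p) (covDerivAlong (stModel m) (metric f) ψ p (onb k p i) (onb k p i))
          (timeField (ψ p))) -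
        ∑ j, metric f (ψ p)
          (covDerivAlong (stModel m) (metric f) ψ p (onb k p i) (onb k p i))
            (mfderiv (𝓡 k) (stModel m) ψ p (onb k p j)) *
          (mfderiv (𝓡 k) (stModel m) ψ p (onb k p j)).1) := by
  -- For k = 0 the factor k⁻¹ is 0 by convention and cannot be cancelled, but the frame is empty and
  -- both sides vanish.
  rcases Nat.eq_zero_or_pos k with hk | hk
  · have : IsEmpty (Fin (Module.finrank ℝ (TangentSpace (𝓡 k) p))) := by
      rw [finrank_tangentSpace, hk]; infer_instance
    simp [hk]
  have hk' : (k : ℝ) ≠ 0 := by positivity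
  have h1 : metric f (ψ p) (meanCurvature (k := k) (stModel m) (metric f) ψ p) (timeField (ψ p)) =
      (k : ℝ)⁻¹ * ∑ i, metric f (ψ p) (secondFundamentalForm (k := k) (stModel m) (metric f) ψ p
        (onb k p i) (onb k p i)) (timeField (ψ p)) := by
    rw [meanCurvature, map_smul, map_sum, smul_apply, sum_apply, smul_eq_mul]
  rw [h1, mul_inv_cancel_left₀ hk']
  refine Finset.sum_congr rfl fun i _ ↦ ?_
  rw [secondFundamentalForm, normalPart, map_neg, map_sub, map_sum, neg_apply, sub_apply, sum_apply,
    neg_sub', sub_eq_add_neg, neg_neg, sub_eq_add_neg, ← Finset.sum_neg_distrib]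
  congr 1
  refine Finset.sum_congr rfl fun j _ ↦ ?_
  rw [map_smul, smul_apply, metric_timeField, smul_eq_mul, mul_neg]

variable [IsManifold (𝓡 m) ∞ F] [IsManifold (𝓡 k) ∞ M]
  [IsContMDiffRiemannianBundle (𝓡 m) ∞ (EuclideanSpace ℝ (Fin m))
    (fun x : F ↦ TangentSpace (𝓡 m) x)]
  [IsContMDiffRiemannianBundle (𝓡 k) ∞ (EuclideanSpace ℝ (Fin k))
    (fun p : M ↦ TangentSpace (𝓡 k) p)]

/-- The Laplacian of the height function in terms of the mean curvature. -/
theorem laplacianInFrame_height {I : Set ℝ} (hI : IsOpen I) {f : ℝ → ℝ} (hf : ContDiffOn ℝ ∞ f I)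
    (hfpos : ∀ t ∈ I, 0 < f t) {ψ : M → ℝ × F}
    (hψ : IsSpacelikeImmersion (m := m) (k := k) I f ψ)
    (hg : IsInducedMetric (m := m) (k := k) f ψ) (p : M) :
    k * metric f (ψ p) (meanCurvature (k := k) (stModel m) (metric f) ψ p) (timeField (ψ p)) =
      laplacianInFrame (chartMetric (𝓡 k) (riemannianForm (𝓡 k)) p) (extChartAt (𝓡 k) p p)
        (chartFrame p) (fun y ↦ (ψ ((extChartAt (𝓡 k) p).symm y)).1) +
      deriv f (ψ p).1 / f (ψ p).1 * (k + ∑ i, fderiv ℝ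
        (fun y ↦ (ψ ((extChartAt (𝓡 k) p).symm y)).1) (extChartAt (𝓡 k) p p)
          (chartFrame p i) ^ 2) := by
  have : IsManifold (𝓡 k) 1 M := IsManifold.of_le (n := ∞) (by simp)
  have : IsManifold (𝓡 m) 1 F := IsManifold.of_le (n := ∞) (by simp)
  set χ : EuclideanSpace ℝ (Fin k) → ℝ × EuclideanSpace ℝ (Fin m) :=
    extChartAt (stModel m) (ψ p) ∘ ψ ∘ (extChartAt (𝓡 k) p).symm with hχdef
  set y := extChartAt (𝓡 k) p p with hy
  have hy_symm : (extChartAt (𝓡 k) p).symm y = p := extChartAt_to_inv p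
  have hχy : χ y = extChartAt (stModel m) (ψ p) (ψ p) := by
    simp only [hχdef, Function.comp_apply, hy_symm]
  have hχy1 : (χ y).1 = (ψ p).1 := by rw [hχy, extChartAt_stModel_apply]
  have hχy2 : (χ y).2 ∈ (extChartAt (𝓡 m) (ψ p).2).target := by
    rw [hχy, extChartAt_stModel_apply]; exact mem_extChartAt_target _
  have hsymm : ContMDiffAt 𝓘(ℝ, EuclideanSpace ℝ (Fin k)) (𝓡 k) ∞ (extChartAt (𝓡 k) p).symm y :=
    (contMDiffOn_extChartAt_symm p).contMDiffAt
      ((isOpen_extChartAt_target p).mem_nhds (mem_extChartAt_target p))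
  have hψs : ContMDiffAt 𝓘(ℝ, EuclideanSpace ℝ (Fin k)) (stModel m) ∞
      (ψ ∘ (extChartAt (𝓡 k) p).symm) y := hψ.contMDiff.contMDiffAt.comp y hsymm
  have hχ : ContDiffAt ℝ ∞ χ y := by
    refine ContMDiffAt.contDiffAt (ContMDiffAt.comp y ?_ hψs)
    simp only [Function.comp_apply, hy_symm]
    exact contMDiffAt_extChartAt
  have hχ2 : ContDiffAt ℝ 2 χ y := hχ.of_le ENat.LEInfty.out
  have hτ : (fun y ↦ (ψ ((extChartAt (𝓡 k) p).symm y)).1) = fun y ↦ (χ y).1 := by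
    funext z
    simp only [hχdef, Function.comp_apply, extChartAt_stModel_apply]
  set g := chartMetric (𝓡 k) (riemannianForm (𝓡 k)) p with hgdef
  set G := chartMetric (stModel m) (metric f) (ψ p) with hGdef
  have hpull : ∀ᶠ z in 𝓝 y, ∀ v w, g z v w = G (χ z) (fderiv ℝ χ z v) (fderiv ℝ χ z w) := by
    filter_upwards [(isOpen_extChartAt_target p).mem_nhds (mem_extChartAt_target p),
      hψs.continuousAt.preimage_mem_nhds (t := (extChartAt (stModel m) (ψ p)).source) (by
        simp only [Function.comp_apply, hy_symm]
        exact extChartAt_source_mem_nhds (ψ p))] with z hz hz' v w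
    exact chartMetric_pullback hz hz' (hψ.contMDiff.mdifferentiableAt (by simp))
      (fun v w ↦ hg _ v w) v w
  have hgd : DifferentiableAt ℝ g y := ((contDiffOn_chartMetric_riemannianForm p).contDiffAt
    ((isOpen_extChartAt_target p).mem_nhds (mem_extChartAt_target p))).differentiableAt (by simp)
  have hGd : DifferentiableAt ℝ G (χ y) :=
    differentiableAt_chartMetric_metric hI hf (by rw [hχy1]; exact hψ.mem p) hχy2
  have hGs : ∀ a b, G (χ y) a b = G (χ y) b a := chartMetric_metric_symm f (ψ p) hχy2
  have hmetric : ∀ a b : ℝ × EuclideanSpace ℝ (Fin m),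
      metric f (ψ p) (a : TangentSpace (stModel m) (ψ p)) (b : TangentSpace (stModel m) (ψ p)) =
        G (χ y) a b := fun a b ↦ by rw [hχy]; exact (chartMetric_self _ _ a b).symm
  have hmf : ∀ v : EuclideanSpace ℝ (Fin k),
      @Eq (ℝ × EuclideanSpace ℝ (Fin m)) (mfderiv (𝓡 k) (stModel m) ψ p v) (fderiv ℝ χ y v) := by
    intro v
    rw [(hψ.contMDiff.mdifferentiableAt (by simp) : MDifferentiableAt _ _ ψ p).mfderiv,
      ModelWithCorners.range_eq_univ, fderivWithin_univ]
    rfl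
  have hcov : ∀ X : EuclideanSpace ℝ (Fin k), @Eq (ℝ × EuclideanSpace ℝ (Fin m))
      (covDerivAlong (stModel m) (metric f) ψ p (X : TangentSpace (𝓡 k) p) X)
      (fderiv ℝ (fderiv ℝ χ) y X X + christoffel G (χ y) (fderiv ℝ χ y X) (fderiv ℝ χ y X)) :=
    fun X ↦ rfl
  have hfp : 0 < f (χ y).1 := by rw [hχy1]; exact hfpos _ (hψ.mem p)
  have hchr := chartMetric_metric_christoffel (f := f) (q := ψ p) hfp hχy2
  -- Gauss formula: tangential components of the ambient derivative are the lowered Christoffel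
  -- symbols of the induced metric.
  have hB : ∀ X W : EuclideanSpace ℝ (Fin k),
      metric f (ψ p) (covDerivAlong (stModel m) (metric f) ψ p (X : TangentSpace (𝓡 k) p) X)
        (mfderiv (𝓡 k) (stModel m) ψ p W) = christoffelLower g y X X W := by
    intro X W
    refine (hmetric _ _).trans ?_
    rw [hmf, hcov, map_add, add_apply, hchr, ← hGdef,
      christoffelLower_pullback hχ2 hgd hGd hGs hpull]
  have hτ1 : ∀ v, fderiv ℝ (fun y ↦ (χ y).1) y v = (fderiv ℝ χ y v).1 := fun v ↦ by
    rw [(hχ2.differentiableAt (by norm_num)).hasFDerivAt.fst.fderiv]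
    rfl
  have hτ2 : ∀ v w, fderiv ℝ (fderiv ℝ (fun y ↦ (χ y).1)) y v w =
      (fderiv ℝ (fderiv ℝ χ) y v w).1 := fun v w ↦ by
    have hev : fderiv ℝ (fun y ↦ (χ y).1) =ᶠ[𝓝 y] fun z ↦
        (ContinuousLinearMap.fst ℝ ℝ (EuclideanSpace ℝ (Fin m))).comp (fderiv ℝ χ z) := by
      filter_upwards [hχ2.eventually (by simp)] with z hz
      exact (hz.differentiableAt (by norm_num)).hasFDerivAt.fst.fderiv
    have hd := (hasFDerivAt_const
      (ContinuousLinearMap.fst ℝ ℝ (EuclideanSpace ℝ (Fin m))) y).clm_comp (hasFDerivAt_fderiv hχ2)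
    rw [hev.fderiv_eq, hd.fderiv]
    simp
  have hA : ∀ X : EuclideanSpace ℝ (Fin k), g y X X = 1 →
      metric f (ψ p) (covDerivAlong (stModel m) (metric f) ψ p (X : TangentSpace (𝓡 k) p) X)
        (timeField (ψ p)) = -(fderiv ℝ (fderiv ℝ (fun y ↦ (χ y).1)) y X X +
          deriv f (ψ p).1 / f (ψ p).1 * (1 + fderiv ℝ (fun y ↦ (χ y).1) y X ^ 2)) := by
    intro X hX
    refine (hmetric _ (1, 0)).trans ?_
    rw [hcov, map_add, add_apply, hchr, christoffelLower_chartMetric_metric hI hf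
      (by rw [hχy1]; exact hψ.mem p) hχy2, hτ1, hτ2, ← hχy1]
    -- For a unit vector X the fibre part of dψ X has squared length 1 + dτ(X)², warping factor f²
    -- included. This turns the Christoffel term into (f'/f)(1 + dτ(X)²).
    rw [hpull.self_of_nhds, hGdef, chartMetric_metric f _ hχy2] at hX
    rw [hGdef, chartMetric_metric f _ hχy2]
    simp only [map_zero, mul_zero, add_zero, mul_one]
    field_simp
    rw [← hX]
    ring
  have hterm : ∀ X : EuclideanSpace ℝ (Fin k), g y X X = 1 →
      -(metric f (ψ p) (covDerivAlong (stModel m) (metric f) ψ p (X : TangentSpace (𝓡 k) p) X)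
          (timeField (ψ p))) -
        ∑ j, metric f (ψ p)
          (covDerivAlong (stModel m) (metric f) ψ p (X : TangentSpace (𝓡 k) p) X)
            (mfderiv (𝓡 k) (stModel m) ψ p (onb k p j)) *
          (mfderiv (𝓡 k) (stModel m) ψ p (onb k p j)).1 =
      (fderiv ℝ (fderiv ℝ (fun y ↦ (χ y).1)) y X X -
        ∑ j, christoffelLower g y X X (chartFrame p j) *
          fderiv ℝ (fun y ↦ (χ y).1) y (chartFrame p j)) +
      deriv f (ψ p).1 / f (ψ p).1 * (1 + fderiv ℝ (fun y ↦ (χ y).1) y X ^ 2) := by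
    intro X hX
    rw [hA X hX, ← sum_onb p fun W : EuclideanSpace ℝ (Fin k) ↦
      christoffelLower g y X X W * fderiv ℝ (fun y ↦ (χ y).1) y W]
    have : ∀ j, metric f (ψ p)
          (covDerivAlong (stModel m) (metric f) ψ p (X : TangentSpace (𝓡 k) p) X)
            (mfderiv (𝓡 k) (stModel m) ψ p (onb k p j)) *
          (mfderiv (𝓡 k) (stModel m) ψ p (onb k p j)).1 =
        christoffelLower g y X X (onb k p j) * fderiv ℝ (fun y ↦ (χ y).1) y (onb k p j) :=
      fun j ↦ congrArg₂ (· * ·) (hB X _) ((congrArg Prod.fst (hmf _)).trans (hτ1 _).symm)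
    rw [Finset.sum_congr rfl fun j _ ↦ this j]
    ring
  have hone : ∀ i, g y (chartFrame p i) (chartFrame p i) = 1 := fun i ↦
    ((isOrthonormalFrame_chartFrame p).orthonormal i i).trans (if_pos rfl)
  rw [metric_meanCurvature_timeField, hτ]
  refine (sum_onb p fun X : EuclideanSpace ℝ (Fin k) ↦
      -(metric f (ψ p) (covDerivAlong (stModel m) (metric f) ψ p (X : TangentSpace (𝓡 k) p) X)
          (timeField (ψ p))) -
        ∑ j, metric f (ψ p)
          (covDerivAlong (stModel m) (metric f) ψ p (X : TangentSpace (𝓡 k) p) X)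
            (mfderiv (𝓡 k) (stModel m) ψ p (onb k p j)) *
          (mfderiv (𝓡 k) (stModel m) ψ p (onb k p j)).1).trans ?_
  rw [Finset.sum_congr rfl fun i _ ↦ hterm _ (hone i), Finset.sum_add_distrib, ← Finset.mul_sum,
    Finset.sum_add_distrib, laplacianInFrame]
  simp

end MeanCurvature

/-! ### The strong maximum principle on a Riemannian manifold -/

section ManifoldMaximumPrinciple

theorem laplacianInFrame_congr {E : Type*} [NormedAddCommGroup E] [NormedSpace ℝ E] {ι : Type*}
    [Fintype ι] (B : E → E →L[ℝ] E →L[ℝ] ℝ) {y : E} (e : ι → E) {φ φ' : E → ℝ}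
    (h : φ =ᶠ[𝓝 y] φ') : laplacianInFrame B y e φ = laplacianInFrame B y e φ' := by
  simp only [laplacianInFrame, h.fderiv_eq, h.fderiv.fderiv_eq]

theorem laplacianInFrame_neg {E : Type*} [NormedAddCommGroup E] [NormedSpace ℝ E] {ι : Type*}
    [Fintype ι] (B : E → E →L[ℝ] E →L[ℝ] ℝ) (y : E) (e : ι → E) (φ : E → ℝ) :
    laplacianInFrame B y e (-φ) = -laplacianInFrame B y e φ := by
  have h1 : fderiv ℝ (-φ) = -fderiv ℝ φ := funext fun z ↦ fderiv_neg
  simp only [laplacianInFrame, h1, fderiv_neg, neg_apply, mul_neg,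
    ← Finset.sum_neg_distrib]
  exact Finset.sum_congr rfl fun i _ ↦ by rw [Finset.sum_neg_distrib]; ring

variable {k : ℕ} {M : Type*} [TopologicalSpace M] [ChartedSpace (EuclideanSpace ℝ (Fin k)) M]
  [RiemannianBundle (fun p : M ↦ TangentSpace (𝓡 k) p)] [IsManifold (𝓡 k) ∞ M]
  [IsContMDiffRiemannianBundle (𝓡 k) ∞ (EuclideanSpace ℝ (Fin k))
    (fun p : M ↦ TangentSpace (𝓡 k) p)]

/-- A smooth function satisfying `Δ u ≤ c |∇ u|²` is locally constant at a minimum. -/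
theorem eventually_eq_of_laplacian_le {u c : M → ℝ} (hu : ContMDiff (𝓡 k) 𝓘(ℝ, ℝ) ∞ u)
    (hc : Continuous c)
    (hlap : ∀ p, laplacianInFrame (chartMetric (𝓡 k) (riemannianForm (𝓡 k)) p)
        (extChartAt (𝓡 k) p p) (chartFrame p) (u ∘ (extChartAt (𝓡 k) p).symm) ≤
      c p * ∑ i, fderiv ℝ (u ∘ (extChartAt (𝓡 k) p).symm) (extChartAt (𝓡 k) p p)
        (chartFrame p i) ^ 2)
    {p₀ : M} (hmin : ∀ p, u p₀ ≤ u p) : ∀ᶠ p in 𝓝 p₀, u p = u p₀ := by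
  have : IsManifold (𝓡 k) 1 M := IsManifold.of_le (n := ∞) (by simp)
  have husymm : ∀ q : M, ContDiffOn ℝ ∞ (u ∘ (extChartAt (𝓡 k) q).symm)
      (extChartAt (𝓡 k) q).target := fun q ↦
    (hu.comp_contMDiffOn (contMDiffOn_extChartAt_symm q)).contDiffOn
  have hsymm₀ : (extChartAt (𝓡 k) p₀).symm (extChartAt (𝓡 k) p₀ p₀) = p₀ := extChartAt_to_inv p₀
  have key := eventually_eq_of_laplacianInFrame_le (ι := Fin k)
    (isOpen_extChartAt_target (I := 𝓡 k) p₀)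
    ((contDiffOn_chartMetric_riemannianForm p₀).of_le (by simp))
    (fun y hy v hv ↦ chartMetric_riemannianForm_pos hy hv)
    (u := u ∘ (extChartAt (𝓡 k) p₀).symm) (c := c ∘ (extChartAt (𝓡 k) p₀).symm)
    ((husymm p₀).of_le ENat.LEInfty.out)
    (hc.comp_continuousOn (continuousOn_extChartAt_symm p₀)) ?_
    (mem_extChartAt_target p₀) (fun y _ ↦ by simpa only [Function.comp_apply, hsymm₀] using hmin _)
  · filter_upwards [(continuousAt_extChartAt p₀).eventually key,
      extChartAt_source_mem_nhds (I := 𝓡 k) p₀] with p hp hps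
    simpa only [Function.comp_apply, hsymm₀, (extChartAt (𝓡 k) p₀).left_inv hps] using hp
  · intro z hz
    -- The hypothesis at q is stated in the chart centred at q. The transition map χ carries it,
    -- together with a pulled-back frame, to the fixed chart at p₀.
    set q := (extChartAt (𝓡 k) p₀).symm z with hq
    set χ := extChartAt (𝓡 k) q ∘ id ∘ (extChartAt (𝓡 k) p₀).symm with hχdef
    have hχz : χ z = extChartAt (𝓡 k) q q := rfl
    have hsymm : ContMDiffAt 𝓘(ℝ, EuclideanSpace ℝ (Fin k)) (𝓡 k) ∞
        (extChartAt (𝓡 k) p₀).symm z :=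
      (contMDiffOn_extChartAt_symm p₀).contMDiffAt ((isOpen_extChartAt_target p₀).mem_nhds hz)
    have hχ : ContDiffAt ℝ 2 χ z := by
      have : ContDiffAt ℝ ∞ χ z := (ContMDiffAt.comp z contMDiffAt_extChartAt hsymm).contDiffAt
      exact this.of_le ENat.LEInfty.out
    have hnear : ∀ᶠ y in 𝓝 z, y ∈ (extChartAt (𝓡 k) p₀).target ∧
        (extChartAt (𝓡 k) p₀).symm y ∈ (extChartAt (𝓡 k) q).source :=
      Filter.Eventually.and ((isOpen_extChartAt_target p₀).mem_nhds hz)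
        (hsymm.continuousAt.preimage_mem_nhds (extChartAt_source_mem_nhds q))
    set g₀ := chartMetric (𝓡 k) (riemannianForm (𝓡 k)) p₀ with hg₀
    set g := chartMetric (𝓡 k) (riemannianForm (𝓡 k)) q with hg
    have hpull : ∀ᶠ y in 𝓝 z, ∀ v w, g₀ y v w = g (χ y) (fderiv ℝ χ y v) (fderiv ℝ χ y w) := by
      filter_upwards [hnear] with y hy v w
      refine chartMetric_pullback (Φ := id) hy.1 hy.2 mdifferentiableAt_id (fun v w ↦ ?_) v w
      rw [mfderiv_id]
      rfl
    have hpz := hpull.self_of_nhds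
    -- An isometry of positive definite forms is injective, hence bijective in equal finite
    -- dimension, so the frame at q can be pulled back.
    have hinj : Function.Injective (fderiv ℝ χ z) := by
      refine (injective_iff_map_eq_zero _).2 fun v hv ↦ ?_
      by_contra hv0
      have := chartMetric_riemannianForm_pos hz hv0
      rw [← hg₀, hpz, hv, map_zero] at this
      exact lt_irrefl _ this
    have hsurj : Function.Surjective (fderiv ℝ χ z) :=
      (LinearMap.injective_iff_surjective
        (f := (fderiv ℝ χ z : EuclideanSpace ℝ (Fin k) →ₗ[ℝ] EuclideanSpace ℝ (Fin k)))).1 hinj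
    choose e he using fun i ↦ hsurj (chartFrame q i)
    have hframe : IsOrthonormalFrame (g (χ z)) (chartFrame q) := isOrthonormalFrame_chartFrame q
    have hdiff : ∀ (r : M) {y}, y ∈ (extChartAt (𝓡 k) r).target →
        DifferentiableAt ℝ (chartMetric (𝓡 k) (riemannianForm (𝓡 k)) r) y := fun r y hy ↦
      ((contDiffOn_chartMetric_riemannianForm r).contDiffAt
        ((isOpen_extChartAt_target r).mem_nhds hy)).differentiableAt (by simp)
    have hcomp : u ∘ (extChartAt (𝓡 k) p₀).symm =ᶠ[𝓝 z]
        (u ∘ (extChartAt (𝓡 k) q).symm) ∘ χ := by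
      filter_upwards [hnear] with y hy
      exact congrArg u ((extChartAt (𝓡 k) q).left_inv hy.2).symm
    have huq : ContDiffAt ℝ 2 (u ∘ (extChartAt (𝓡 k) q).symm) (χ z) :=
      ((husymm q).contDiffAt ((isOpen_extChartAt_target q).mem_nhds
        (mem_extChartAt_target q))).of_le ENat.LEInfty.out
    refine ⟨e, ⟨fun i j ↦ ?_, fun v ↦ hinj ?_⟩, ?_⟩
    · rw [hpz, he, he, hframe.orthonormal]
    · simp only [map_sum, map_smul, he, hpz]
      exact hframe.expansion _
    · rw [laplacianInFrame_congr _ _ hcomp, laplacianInFrame_pullback hχ (hdiff p₀ hz)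
        (hdiff q (mem_extChartAt_target q)) (chartMetric_riemannianForm_symm q _) hpull he hframe
        huq]
      refine (hlap q).trans (le_of_eq ?_)
      refine congrArg₂ (· * ·) rfl (Finset.sum_congr rfl fun i _ ↦ ?_)
      rw [hcomp.fderiv_eq, fderiv_comp z (huq.differentiableAt (by norm_num))
        (hχ.differentiableAt (by norm_num)), ContinuousLinearMap.comp_apply, he, hχz]

end ManifoldMaximumPrinciple

/-! ### Comparison with the limit at infinity -/

section Conclusion

variable {k : ℕ} {M : Type*} [MetricSpace M] [ConnectedSpace M] [NoncompactSpace M]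
  [CompleteSpace M] [ChartedSpace (EuclideanSpace ℝ (Fin k)) M] [IsManifold (𝓡 k) ∞ M]
  [RiemannianBundle (fun p : M ↦ TangentSpace (𝓡 k) p)]
  [IsContMDiffRiemannianBundle (𝓡 k) ∞ (EuclideanSpace ℝ (Fin k))
    (fun p : M ↦ TangentSpace (𝓡 k) p)]
  [IsRiemannianManifold (𝓡 k) M]

/-- On a complete non-compact connected manifold, a function satisfying `Δ u ≤ c |∇ u|²` is bounded
below by its limit at infinity. -/
theorem le_of_laplacian_le_of_tendsto {u c : M → ℝ} (hu : ContMDiff (𝓡 k) 𝓘(ℝ, ℝ) ∞ u)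
    (hc : Continuous c)
    (hlap : ∀ p, laplacianInFrame (chartMetric (𝓡 k) (riemannianForm (𝓡 k)) p)
        (extChartAt (𝓡 k) p p) (chartFrame p) (u ∘ (extChartAt (𝓡 k) p).symm) ≤
      c p * ∑ i, fderiv ℝ (u ∘ (extChartAt (𝓡 k) p).symm) (extChartAt (𝓡 k) p p)
        (chartFrame p i) ^ 2)
    {o : M} {a : ℝ} (hlim : Tendsto u (comap (fun p ↦ dist p o) atTop) (𝓝 a)) (p : M) :
    a ≤ u p := by
  have : ProperSpace M := IsRiemannianManifold.properSpace (𝓡 k) M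
  by_contra! hp
  -- Properness, hence completeness, is used here.
  have hcocomp : comap (fun p ↦ dist p o) atTop = cocompact M := by
    simp only [dist_comm _ o]
    exact comap_dist_left_atTop_eq_cocompact o
  rw [hcocomp] at hlim
  -- As u p < a, the values of u exceed u p off a compact set, so the infimum is attained.
  obtain ⟨p₀, hp₀⟩ : ∃ p₀, ∀ q, u p₀ ≤ u q :=
    hu.continuous.exists_forall_le' p
      ((hlim.eventually (lt_mem_nhds hp)).mono fun q hq ↦ hq.le)
  have hopen : IsOpen {q | u q = u p₀} := isOpen_iff_mem_nhds.2 fun q hq ↦ by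
    have := eventually_eq_of_laplacian_le hu hc hlap (p₀ := q) fun r ↦ by
      rw [show u q = u p₀ from hq]; exact hp₀ r
    exact this.mono fun r hr ↦ hr.trans hq
  have hclosed : IsClosed {q | u q = u p₀} := isClosed_eq hu.continuous continuous_const
  have huniv : {q | u q = u p₀} = Set.univ := IsClopen.eq_univ ⟨hclosed, hopen⟩ ⟨p₀, rfl⟩
  have hconst : u = fun _ ↦ u p₀ := funext fun q ↦ huniv.symm.subset (Set.mem_univ q)
  rw [hconst] at hlim
  -- Noncompactness makes the cocompact filter nontrivial, so the constant value must be a, against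
  -- u p₀ ≤ u p < a.
  have := tendsto_nhds_unique hlim tendsto_const_nhds
  linarith [hp₀ p]

end Conclusion

end GRW

end

/-! ### The main theorem -/

theorem theorem4p12 {m k : ℕ} (hm : 2 ≤ m) (hkm : k ≤ m)
    -- the fiber: a connected Riemannian manifold of dimension `m = n - 1`
    {F : Type*} [TopologicalSpace F] [T2Space F] [SecondCountableTopology F] [ConnectedSpace F]
    [ChartedSpace (EuclideanSpace ℝ (Fin m)) F] [IsManifold (𝓡 m) ∞ F]
    [RiemannianBundle (fun x : F ↦ TangentSpace (𝓡 m) x)]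
    [IsContMDiffRiemannianBundle (𝓡 m) ∞ (EuclideanSpace ℝ (Fin m))
      (fun x : F ↦ TangentSpace (𝓡 m) x)]
    -- the open interval and the warping function
    {I : Set ℝ} (hI : IsOpen I) (hI' : I.OrdConnected)
    {f : ℝ → ℝ} (hf : ContDiffOn ℝ ∞ f I) (hfpos : ∀ t ∈ I, 0 < f t)
    (hfint : IntegrableOn f I volume)
    -- a connected, complete, non-compact Riemannian manifold of dimension `k`
    {M : Type*} [MetricSpace M] [ConnectedSpace M] [NoncompactSpace M] [CompleteSpace M]
    [ChartedSpace (EuclideanSpace ℝ (Fin k)) M] [IsManifold (𝓡 k) ∞ M]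
    [RiemannianBundle (fun p : M ↦ TangentSpace (𝓡 k) p)]
    [IsContMDiffRiemannianBundle (𝓡 k) ∞ (EuclideanSpace ℝ (Fin k))
      (fun p : M ↦ TangentSpace (𝓡 k) p)]
    [IsRiemannianManifold (𝓡 k) M]
    -- a spacelike immersion, inducing the Riemannian metric of `M`
    {ψ : M → ℝ × F} (hψ : GRW.IsSpacelikeImmersion (m := m) (k := k) I f ψ)
    (hg : GRW.IsInducedMetric (m := m) (k := k) f ψ)
    {t₀ : ℝ} (ht₀ : t₀ ∈ I) :
    ((∀ p, GRW.metric f (ψ p) (GRW.meanCurvature (k := k) (GRW.stModel m) (GRW.metric f) ψ p)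
          (GRW.timeField (ψ p)) ≤ deriv f (ψ p).1 / f (ψ p).1) →
      (∀ p, (ψ p).1 ≤ t₀) → GRW.IsAsymptoticToSlice ψ t₀ →
      Set.range ψ ⊆ {t₀} ×ˢ Set.univ) ∧
    ((∀ p, deriv f (ψ p).1 / f (ψ p).1 ≤
          GRW.metric f (ψ p) (GRW.meanCurvature (k := k) (GRW.stModel m) (GRW.metric f) ψ p)
          (GRW.timeField (ψ p))) →
      (∀ p, t₀ ≤ (ψ p).1) → GRW.IsAsymptoticToSlice ψ t₀ →
      Set.range ψ ⊆ {t₀} ×ˢ Set.univ) := by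
  have hτ : ContMDiff (𝓡 k) 𝓘(ℝ, ℝ) ∞ fun p ↦ (ψ p).1 := contMDiff_fst.comp hψ.contMDiff
  have hr : Continuous fun p ↦ deriv f (ψ p).1 / f (ψ p).1 :=
    ((hf.continuousOn_deriv_of_isOpen hI (by simp)).div hf.continuousOn
      fun t ht ↦ (hfpos t ht).ne').comp_continuous hτ.continuous hψ.mem
  have hlap := GRW.laplacianInFrame_height hI hf hfpos hψ hg
  refine ⟨fun hH hle ⟨o, ho⟩ ↦ ?_, fun hH hle ⟨o, ho⟩ ↦ ?_⟩
  · rintro _ ⟨p, rfl⟩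
    refine ⟨le_antisymm (hle p) ?_, Set.mem_univ _⟩
    refine GRW.le_of_laplacian_le_of_tendsto (k := k) hτ hr.neg (fun q ↦ ?_) ho p
    -- Multiplied by k, the curvature bound cancels k f'/f in the height formula and leaves Δτ ≤
    -- -(f'/f)|∇τ|².
    have h1 := mul_le_mul_of_nonneg_left (hH q) (Nat.cast_nonneg (α := ℝ) k)
    rw [hlap q] at h1
    have : ∀ a b c d : ℝ, a + b * (c + d) ≤ c * b → a ≤ -b * d := fun a b c d h ↦ by linarith
    exact this _ _ _ _ h1
  · rintro _ ⟨p, rfl⟩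
    refine ⟨le_antisymm ?_ (hle p), Set.mem_univ _⟩
    -- Passing to -τ reverses the sign of the Laplacian but not of |∇τ|², so the coefficient is now
    -- +f'/f.
    have := GRW.le_of_laplacian_le_of_tendsto (k := k) hτ.neg hr (fun q ↦ ?_) ho.neg p
    · exact neg_le_neg_iff.1 this
    have h1 := mul_le_mul_of_nonneg_left (hH q) (Nat.cast_nonneg (α := ℝ) k)
    rw [hlap q] at h1
    have hneg : (fun p ↦ -(ψ p).1) ∘ (extChartAt (𝓡 k) q).symm =
      -fun y ↦ (ψ ((extChartAt (𝓡 k) q).symm y)).1 := rfl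
    have : ∀ a b c d : ℝ, c * b ≤ a + b * (c + d) → -a ≤ b * d := fun a b c d h ↦ by linarith
    simp only [hneg, GRW.laplacianInFrame_neg, fderiv_neg, neg_apply, neg_sq]
    exact this _ _ _ _ h1
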